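/- **Setting.** Let $W$ be the binary erasure channel with erasure probability $z=Z(W)\in[0,1]$ and capacity $I(W)=1-z$. Put $W_1^{(1)}=W$; the synthetic erasure channels $W_{2N}^{(2j-1)}$ and $W_{2N}^{(2j)}$ are obtained from two independent copies of $W_N^{(j)}$ and erase when at least one copy, respectively both copies, erase; thus $Z(W_{2N}^{(2j-1)})=1-(1-Z(W_N^{(j)}))^2$ and $Z(W_{2N}^{(2j)})=Z(W_N^{(j)})^2$. A polar code of block length $N_n=2^n$ is a set $\mathcal A_n\subseteq\{1,\dots,2^n\}$; its rate is $R_n=|\mathcal A_n|/2^n$ and its block error probability $P_n$ is the probability that some channel $W_{2^n}^{(j)}$, $j\in\mathcal A_n$, erases (so $P_n\le S_n:=\sum_{j\in\mathcal A_n}Z(W_{2^n}^{(j)})$). Let $Z_n=Z(W_{2^n}^{(j)})$ with $j$ uniform in $\{1,\dots,2^n\}$ and $\mathbb P_z$ the corresponding probability. The scaling exponent of a series of codes is $\limsup_n\frac{-\log N_n}{\log(I(W)-R_n)}$ (a term counts as $0$ if $I(W)-R_n\le0$, as $+\infty$ if $I(W)-R_n\ge1$); its error exponent is $\liminf_n\frac{\log(-\log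 P_n)}{\log N_n}$ (a term counts as $+\infty$ if $P_n=0$, as $-\infty$ if $P_n=1$). For a fixed bound $P_{\mathrm{ub}}>0$, the scaling exponent of polar coding over $W$ is the infimum of the scaling exponents over all series of polar codes with $S_n\le P_{\mathrm{ub}}$ for all $n$. Let $H_2$ be the binary entropy function in bits. A pair $(\beta',\mu')$ is *achievable* if for every $z\in[0,1]$ there is a series of polar codes with, for all large $n$, $P_n\le S_n\le 2^n\cdot2^{-2^{\beta'n}}$, with $I(W)-R_n=O(2^{-n/\mu'})$, and (consequently) error exponent at least $\beta'$ and scaling exponent at most $\mu'$. A function $h$ *certifies* $\mu^*>2$ if $h:[0,1]\to[0,1]$, $h(0)=h(1)=0$, $h$ is bounded below by a positive constant on every compact subinterval of $(0,1)$ (for instance, $h$ is continuous and positive on $(0,1)$), and $$\sup_{0<\xi<1}\frac{h(\xi^2)+h(2\xi-\xi^2)}{2h(\xi)}<2^{-1/\mu^*}.$$ The *Scaling Assumption* with exponent $\mu>0$: for all $z,a,b\in(0,1)$ with $a<b$, the limit $\lim_{n\to\infty}2^{n/\mu}\,\mathbb P_z(a<Z_n<b)$ exists in $(0,\infty)$.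 The condition that makes $(\beta',\mu')$ achievable, given a certified $\mu^*$, is $$\frac{1-\pi}{\mu'-\mu^*\pi}+H_2\!\left(\frac{\beta'\mu'}{\mu'-\mu^*\pi}\right)<1\quad\text{for all }\pi\in[0,1].\tag{1}$$ **Statement.** (a) For $\mu=3.627$, $$\frac{1-\xi}{\mu}+H_2(0.4469\,\xi)<1\quad\text{for all }\xi\in[0,1].\tag{2}$$ Now let $\mu>0$ be any number satisfying (2), for instance $\mu=3.627$. (b) If $h$ certifies $\mu^*\ge\mu$ and $0<\gamma<1$, then $\mu'=\mu^*/(1-\gamma)$ and $\beta'=0.4469\,\gamma$ satisfy (1), and $(\beta',\mu')$ is achievable. (c) Suppose that the Scaling Assumption holds with exponent $\mu$. Then every $\mu^*>\mu$ is certified by some $h$. Hence, letting $\gamma\to0$ and $\mu^*\to\mu$, the exponent $\mu'$ in (b) tends to $\mu$ (not to $1+\mu$): for every $\varepsilon>0$ there are $\mu^*>\mu$, a function $h$ certifying $\mu^*$, and $\gamma\in(0,1)$ such that $\beta'=0.4469\,\gamma>0$ and $\mu'=\mu^*/(1-\gamma)\in(\mu,\mu+\varepsilon)$ satisfy (1)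 and $(\beta',\mu')$ is achievable. This limit is the true scaling exponent: for every $z\in(0,1)$ and every $P_{\mathrm{ub}}>0$ the scaling exponent of polar coding over $W$ is equal to $\mu$. -/

import Mathlib

open Set Filter Topology

noncomputable section

/-- Binary entropy measured in bits. -/
def H2 (p : ℝ) : ℝ := Real.binEntropy p / Real.log 2

/-- Erasure probability of the `j`-th (`0 ≤ j < 2 ^ n`) synthetic channel at depth `n`, starting
from the binary erasure channel with erasure probability `z`. Indices start at `0`, so that the
channel of index `j` has the two children `2 * j` (probability `1 - (1 - Z) ^ 2`) and `2 * j + 1`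
(probability `Z ^ 2`). -/
def synthZ (z : ℝ) : ℕ → ℕ → ℝ
  | 0, _ => z
  | n + 1, j =>
      if j % 2 = 0 then 1 - (1 - synthZ z n (j / 2)) ^ 2 else synthZ z n (j / 2) ^ 2

/-- A polar code of block length `2 ^ n`: the set of synthetic channels that carry information. -/
abbrev PolarCode (n : ℕ) := Finset (Fin (2 ^ n))

/-- A series of polar codes, one for each block length `2 ^ n`. -/
abbrev PolarSeries := (n : ℕ) → PolarCode n

/-- Code rate. -/
def PolarCode.rate {n : ℕ} (A : PolarCode n) : ℝ := (A.card : ℝ) / 2 ^ n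

/-- Gap to the capacity `1 - z` of the binary erasure channel of erasure probability `z`. -/
def PolarCode.gap {n : ℕ} (z : ℝ) (A : PolarCode n) : ℝ := (1 - z) - A.rate

/-- The sum of the erasure probabilities of the synthetic channels in the code. -/
def PolarCode.sumErr {n : ℕ} (z : ℝ) (A : PolarCode n) : ℝ :=
  ∑ j ∈ A, synthZ z n (j : ℕ)

/-- `e k` says whether the `k`-th of the `2 ^ n` independent copies of the channel erases its
symbol. `synthErased n e j` says whether the `j`-th synthetic channel then erases. Two copies of
a depth `n` channel, living on disjoint blocks of copies, are combined: the first child erases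
if at least one of them does, the second child erases if both do. -/
def synthErased : (n : ℕ) → (Fin (2 ^ n) → Bool) → ℕ → Bool
  | 0, e, _ => e ⟨0, by simp⟩
  | n + 1, e, j =>
      let x := synthErased n (fun k => e ⟨k.1, by have := k.2; rw [pow_succ]; omega⟩) (j / 2)
      let y := synthErased n (fun k => e ⟨2 ^ n + k.1, by have := k.2; rw [pow_succ]; omega⟩)
        (j / 2)
      if j % 2 = 0 then x || y else x && y

open Classical in
/-- Block error probability: the probability that some synthetic channel in the code erases,
when each of the `2 ^ n` copies of the channel erases independently with probability `z`. -/
def PolarCode.blockErr {n : ℕ} (z : ℝ) (A : PolarCode n) : ℝ :=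
  ∑ e : Fin (2 ^ n) → Bool,
    if ∃ j ∈ A, synthErased n e (j : ℕ) = true then ∏ k, (if e k then z else 1 - z) else 0

/-- `liminf log (- log P_n) / log N_n`. A code with `P_n = 0` counts as `+∞`, a code with
`P_n = 1` as `-∞`. -/
def errorExponent (z : ℝ) (A : PolarSeries) : EReal :=
  liminf (fun n : ℕ =>
    if (A n).blockErr z ≤ 0 then (⊤ : EReal)
    else if 1 ≤ (A n).blockErr z then (⊥ : EReal)
    else ((Real.log (-Real.log ((A n).blockErr z)) / Real.log (2 ^ n) : ℝ) : EReal)) atTop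

/-- `limsup (- log N_n) / log (I(W) - R_n)`. A code with non-positive gap counts as `0`, a code
with gap at least `1` as `+∞`. -/
def seriesScalingExponent (z : ℝ) (A : PolarSeries) : EReal :=
  limsup (fun n : ℕ =>
    if (A n).gap z ≤ 0 then (0 : EReal)
    else if 1 ≤ (A n).gap z then (⊤ : EReal)
    else ((-Real.log (2 ^ n) / Real.log ((A n).gap z) : ℝ) : EReal)) atTop

/-- The scaling exponent of polar coding: the infimum of the scaling exponents of all series of
polar codes whose union bound on the block error probability never exceeds `Pub`. -/
def polarScalingExponent (z Pub : ℝ) : EReal :=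
  sInf {s | ∃ A : PolarSeries, (∀ n, (A n).sumErr z ≤ Pub) ∧ s = seriesScalingExponent z A}

/-- The series `A` achieves the pair `(β', μ')` over the erasure channel of erasure
probability `z`. -/
structure Achieves (z : ℝ) (A : PolarSeries) (β' μ' : ℝ) : Prop where
  sum_le : ∀ᶠ n : ℕ in atTop,
    (A n).sumErr z ≤ (2 : ℝ) ^ n * (2 : ℝ) ^ (-(2 : ℝ) ^ (β' * (n : ℝ)))
  block_le : ∀ᶠ n : ℕ in atTop,
    (A n).blockErr z ≤ (2 : ℝ) ^ n * (2 : ℝ) ^ (-(2 : ℝ) ^ (β' * (n : ℝ)))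
  gap_isBigO : (fun n : ℕ => (A n).gap z) =O[atTop] fun n : ℕ => (2 : ℝ) ^ (-(n : ℝ) / μ')
  le_errorExponent : (β' : EReal) ≤ errorExponent z A
  scalingExponent_le : seriesScalingExponent z A ≤ (μ' : EReal)

/-- `(β', μ')` is achievable by polar codes, over every binary erasure channel. -/
def Achievable (β' μ' : ℝ) : Prop :=
  ∀ z ∈ Icc (0 : ℝ) 1, ∃ A : PolarSeries, Achieves z A β' μ'

/-- The function `h` certifies the bound `μs` on the scaling exponent. The field `bddBelow`
contains `h > 0` on `(0, 1)`, and holds for every continuous `h` that is positive there; the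
field `sup_lt` says that the supremum of the ratio is less than `2 ^ (-1 / μs)`. -/
structure EigenCriterion (h : ℝ → ℝ) (μs : ℝ) : Prop where
  two_lt : 2 < μs
  mapsTo : MapsTo h (Icc 0 1) (Icc 0 1)
  zero : h 0 = 0
  one : h 1 = 0
  bddBelow : ∀ a b : ℝ, 0 < a → b < 1 → ∃ c : ℝ, 0 < c ∧ ∀ ξ ∈ Icc a b, c ≤ h ξ
  sup_lt : ∃ r : ℝ, r < (2 : ℝ) ^ (-1 / μs) ∧
    ∀ ξ ∈ Ioo (0 : ℝ) 1, (h (ξ ^ 2) + h (2 * ξ - ξ ^ 2)) / (2 * h ξ) ≤ r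

/-- The inequality that makes `(β', μ')` achievable, given a certified bound `μs`. -/
def MainCondition (μs β' μ' : ℝ) : Prop :=
  ∀ π ∈ Icc (0 : ℝ) 1,
    (1 - π) / (μ' - μs * π) + H2 (β' * μ' / (μ' - μs * π)) < 1

/-- The inequality to be checked numerically. -/
def NumericCondition (μ : ℝ) : Prop :=
  ∀ ξ ∈ Icc (0 : ℝ) 1, (1 - ξ) / μ + H2 (0.4469 * ξ) < 1

open Classical in
/-- `ℙ (a < Z_n < b)` for the Bhattacharyya process `Z_n` started at `z`: at time `n` the process
is the erasure probability of a uniformly random synthetic channel of depth `n`. -/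
def probBetween (z a b : ℝ) (n : ℕ) : ℝ :=
  ((Finset.univ.filter fun j : Fin (2 ^ n) =>
    a < synthZ z n (j : ℕ) ∧ synthZ z n (j : ℕ) < b).card : ℝ) / 2 ^ n

/-- The Scaling Assumption, with exponent `μ`: `2 ^ (n / μ) * ℙ (a < Z_n < b)` has a limit in
`(0, ∞)` for all starting points and all `a < b`. -/
def ScalingAssumption (μ : ℝ) : Prop :=
  0 < μ ∧ ∀ z ∈ Ioo (0 : ℝ) 1, ∀ a ∈ Ioo (0 : ℝ) 1, ∀ b ∈ Ioo (0 : ℝ) 1, a < b →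
    ∃ L : ℝ, 0 < L ∧
      Tendsto (fun n : ℕ => (2 : ℝ) ^ ((n : ℝ) / μ) * probBetween z a b n) atTop (𝓝 L)

end

/-! Write T for `polarStep`. Then `polarStep^[n] φ z` is the expectation of φ(Z_n) started at z
(`sum_synthZ`). The code keeps the channels with Z ≤ ε_n = 2^(-2^(β'n)). Since Z_n is a martingale,
its gap is at most E[1 - Z_n; Z_n > ε_n], so (b) reduces to bounding this by a multiple of 2^(-n/μ')
(`exists_tail_bound`).

Two mechanisms share the n steps. While Z_n is not yet polarized, a function ψ with Tψ ≤ ρψ and ρ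
slightly below 2^(-1/μ*) makes the remaining mass decay like ρ^n
(`exists_dominating_eigenfunction`). Once Z_n ≤ 2^(-(n+2)), doublings alone cannot undo this in the
time left, and falling below ε_n takes only about 0.4469γn squarings; a Chernoff bound with tilt θ
controls their number (`polarStep_iterate_indicator_le`). Condition (2) supplies one θ for which γn
steps pay for the target and each further step still gains a factor (1+θ)/2 ≤ ρ (`exists_tilt`). A
path entering the good region at time i therefore contributes about ρ^i · ρ^((1-γ)n - i), the same
for all i, and the total is ρ^((1-γ)n) up to factors that the slack in ρ absorbs. Hence μ' =
μ*/(1-γ).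

For (c), the Scaling Assumption bounds T^n g, with g = (x(1-x))^(1/4), by C_z 2^(-n/μ). Baire's
theorem and transport along synthetic channels make this uniform
(`ScalingAssumption.exists_uniform_bound`), and a truncated Neumann series in T applied to g
certifies any μ* > μ. Conversely, a bounded S_n lets a code use only boundedly many channels with Z
in (1/4, 3/4); the others, of order 2^(n - n/μ), each lose a fixed share of capacity
(`ScalingAssumption.eventually_le_gap`).

For (a), the concave entropy lies below a tangent line, so only ξ = 0 and ξ = 1 need checking. -/

/-! ### The averaging operator and the synthetic channels. -/

/-- One step of the averaging operator of the erasure process. -/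
noncomputable def polarStep (φ : ℝ → ℝ) (x : ℝ) : ℝ := (φ (x ^ 2) + φ (2 * x - x ^ 2)) / 2

lemma sq_mem_unit {x : ℝ} (hx : x ∈ Icc (0 : ℝ) 1) : x ^ 2 ∈ Icc (0 : ℝ) 1 :=
  ⟨by positivity, by nlinarith [hx.1, hx.2]⟩

lemma two_mul_sub_sq_mem_unit {x : ℝ} (hx : x ∈ Icc (0 : ℝ) 1) :
    2 * x - x ^ 2 ∈ Icc (0 : ℝ) 1 :=
  ⟨by nlinarith [hx.1, hx.2], by nlinarith [hx.1, hx.2]⟩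

lemma polarStep_iterate_succ (φ : ℝ → ℝ) (n : ℕ) (x : ℝ) :
    polarStep^[n + 1] φ x =
      (polarStep^[n] φ (x ^ 2) + polarStep^[n] φ (2 * x - x ^ 2)) / 2 := by
  rw [Function.iterate_succ_apply']; rfl

lemma polarStep_iterate_mono {φ ψ : ℝ → ℝ} (h : ∀ x ∈ Icc (0 : ℝ) 1, φ x ≤ ψ x) (n : ℕ) :
    ∀ x ∈ Icc (0 : ℝ) 1, polarStep^[n] φ x ≤ polarStep^[n] ψ x := by
  induction n with
  | zero => exact h
  | succ n ih =>
    intro x hx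
    rw [polarStep_iterate_succ, polarStep_iterate_succ]
    linarith [ih _ (sq_mem_unit hx), ih _ (two_mul_sub_sq_mem_unit hx)]

lemma polarStep_iterate_linear (φ ψ : ℝ → ℝ) (a b : ℝ) (n : ℕ) (x : ℝ) :
    polarStep^[n] (fun y => a * φ y + b * ψ y) x =
      a * polarStep^[n] φ x + b * polarStep^[n] ψ x := by
  induction n generalizing x with
  | zero => rfl
  | succ n ih => simp only [polarStep_iterate_succ, ih]; ring

lemma polarStep_iterate_const (c : ℝ) (n : ℕ) (x : ℝ) : polarStep^[n] (fun _ => c) x = c := by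
  induction n generalizing x with
  | zero => rfl
  | succ n ih => simp only [polarStep_iterate_succ, ih]; ring

lemma polarStep_iterate_nonneg {φ : ℝ → ℝ} (h : ∀ x ∈ Icc (0 : ℝ) 1, 0 ≤ φ x) (n : ℕ) :
    ∀ x ∈ Icc (0 : ℝ) 1, 0 ≤ polarStep^[n] φ x := by
  intro x hx
  have := polarStep_iterate_mono h n x hx
  rwa [polarStep_iterate_const] at this

lemma polarStep_iterate_id (n : ℕ) (x : ℝ) : polarStep^[n] (fun y => y) x = x := by
  induction n generalizing x with
  | zero => rfl
  | succ n ih => simp only [polarStep_iterate_succ, ih]; ring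

lemma polarStep_iterate_one_sub (n : ℕ) (x : ℝ) : polarStep^[n] (fun y => 1 - y) x = 1 - x := by
  induction n generalizing x with
  | zero => rfl
  | succ n ih => simp only [polarStep_iterate_succ, ih]; ring

lemma polarStep_iterate_pow_le {φ : ℝ → ℝ} {ρ : ℝ} (hρ : 0 ≤ ρ)
    (h : ∀ x ∈ Icc (0 : ℝ) 1, ρ * φ x ≤ polarStep φ x) (n : ℕ) :
    ∀ x ∈ Icc (0 : ℝ) 1, ρ ^ n * φ x ≤ polarStep^[n] φ x := by
  induction n with
  | zero => intro x _; simp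
  | succ n ih =>
    intro x hx
    rw [polarStep_iterate_succ]
    have h1 := ih _ (sq_mem_unit hx)
    have h2 := ih _ (two_mul_sub_sq_mem_unit hx)
    have h3 := mul_le_mul_of_nonneg_left (h x hx) (pow_nonneg hρ n)
    simp only [polarStep] at h3
    rw [pow_succ ρ]; linarith

lemma synthZ_mem {z : ℝ} (hz : z ∈ Icc (0 : ℝ) 1) (n j : ℕ) : synthZ z n j ∈ Icc (0 : ℝ) 1 := by
  induction n generalizing j with
  | zero => exact hz
  | succ n ih =>
    simp only [synthZ]
    split_ifs
    · convert two_mul_sub_sq_mem_unit (ih (j / 2)) using 1; ring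
    · exact sq_mem_unit (ih (j / 2))

lemma continuous_synthZ (n j : ℕ) : Continuous fun z => synthZ z n j := by
  induction n generalizing j with
  | zero => exact continuous_id
  | succ n ih =>
    have := ih (j / 2)
    simp only [synthZ]
    split_ifs <;> fun_prop

lemma sum_range_two_mul (F : ℕ → ℝ) (N : ℕ) :
    ∑ j ∈ Finset.range (N * 2), F j = ∑ j ∈ Finset.range N, (F (2 * j) + F (2 * j + 1)) := by
  induction N with
  | zero => simp
  | succ N ih =>
    rw [Nat.succ_mul, Finset.sum_range_succ, Finset.sum_range_succ, ih, Finset.sum_range_succ,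
      mul_comm N 2]
    ring

lemma sum_synthZ (φ : ℝ → ℝ) (z : ℝ) (n : ℕ) :
    ∑ j : Fin (2 ^ n), φ (synthZ z n j) = 2 ^ n * polarStep^[n] φ z := by
  rw [Fin.sum_univ_eq_sum_range (fun j => φ (synthZ z n j))]
  induction n generalizing φ with
  | zero => simp [synthZ]
  | succ n ih =>
    rw [pow_succ, sum_range_two_mul, Function.iterate_succ_apply, pow_succ, mul_right_comm,
      ← ih (polarStep φ), Finset.sum_mul]
    refine Finset.sum_congr rfl fun j _ => ?_
    have h1 : (2 * j) / 2 = j := by omega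
    have h2 : (2 * j + 1) / 2 = j := by omega
    have h3 : (2 * j) % 2 = 0 := by omega
    have h4 : ¬ (2 * j + 1) % 2 = 0 := by omega
    simp only [synthZ, h1, h2, h3, h4, if_true, if_false, polarStep]
    rw [show 1 - (1 - synthZ z n j) ^ 2 = 2 * synthZ z n j - synthZ z n j ^ 2 by ring]
    ring

/-- A single term is at most the whole sum. A bound at one starting point thus passes, at the cost
of a factor 2^n, to every point reachable from it. -/
lemma le_two_pow_mul_polarStep_iterate {φ : ℝ → ℝ} (h : ∀ x ∈ Icc (0 : ℝ) 1, 0 ≤ φ x) {z : ℝ}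
    (hz : z ∈ Icc (0 : ℝ) 1) (n : ℕ) (j : Fin (2 ^ n)) :
    φ (synthZ z n j) ≤ 2 ^ n * polarStep^[n] φ z := by
  rw [← sum_synthZ]
  exact Finset.single_le_sum (f := fun j : Fin (2 ^ n) => φ (synthZ z n j))
    (fun i _ => h _ (synthZ_mem hz n i)) (Finset.mem_univ j)

open Classical in
lemma probBetween_eq (z a b : ℝ) (n : ℕ) :
    probBetween z a b n = polarStep^[n] (fun x => if a < x ∧ x < b then 1 else 0) z := by
  have h := sum_synthZ (fun x => if a < x ∧ x < b then (1 : ℝ) else 0) z n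
  rw [probBetween, div_eq_iff (by positivity), mul_comm, ← h, Finset.card_filter]
  push_cast
  rfl

/-! ### The union bound -/

/-- Splitting the `2 ^ (n + 1)` copies of the channel into two blocks. -/
def blockSplit (n : ℕ) : Fin (2 ^ n) ⊕ Fin (2 ^ n) ≃ Fin (2 ^ (n + 1)) :=
  finSumFinEquiv.trans (finCongr (by rw [pow_succ]; omega))

lemma sum_bool_blocks (n : ℕ) (F : (Fin (2 ^ (n + 1)) → Bool) → ℝ) :
    ∑ e, F e = ∑ x : Fin (2 ^ n) → Bool, ∑ y : Fin (2 ^ n) → Bool,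
      F (fun k => Sum.elim x y ((blockSplit n).symm k)) := by
  rw [← Fintype.sum_prod_type']
  symm
  refine Fintype.sum_equiv ((Equiv.sumArrowEquivProdArrow _ _ _).symm.trans
    (Equiv.arrowCongr (blockSplit n) (Equiv.refl Bool))) _ _ ?_
  rintro ⟨x, y⟩
  rfl

/-- The two copies use disjoint blocks, so the weight of an erasure pattern factors; the first child
is inclusion-exclusion, the second a product. -/
lemma sum_synthErased (z : ℝ) (n j : ℕ) :
    ∑ e : Fin (2 ^ n) → Bool,
      (if synthErased n e j = true then ∏ k, (if e k then z else 1 - z) else 0) = synthZ z n j := by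
  have total : ∀ n, ∑ e : Fin (2 ^ n) → Bool, ∏ k, (if e k then z else 1 - z) = 1 := by
    intro n
    have h := Finset.prod_univ_sum (fun _ : Fin (2 ^ n) => (Finset.univ : Finset Bool))
      (fun _ b => if b then z else 1 - z)
    simp only [Fintype.piFinset_univ] at h
    rw [← h]; simp
  induction n generalizing j with
  | zero =>
    have hu : Unique (Fin (2 ^ 0)) := inferInstanceAs (Unique (Fin 1))
    rw [Fintype.sum_equiv (Equiv.funUnique (Fin (2 ^ 0)) Bool) _
      (fun b => if b = true then z else 0)]
    · simp [synthZ]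
    · intro e
      obtain ⟨b, rfl⟩ : ∃ b, e = fun _ => b :=
        ⟨e default, funext fun k => congrArg e (Subsingleton.elim _ _)⟩
      cases b <;> simp [synthErased]
  | succ n ih =>
    set p : (Fin (2 ^ n) → Bool) → ℝ := fun x => ∏ k, (if x k then z else 1 - z) with hp
    set E : (Fin (2 ^ n) → Bool) → Bool := fun x => synthErased n x (j / 2) with hE
    have hsplit : ∀ x y : Fin (2 ^ n) → Bool,
        ∏ k, (if Sum.elim x y ((blockSplit n).symm k) then z else 1 - z) = p x * p y := by
      intro x y
      rw [← Equiv.prod_comp (blockSplit n)]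
      simp only [Equiv.symm_apply_apply, Fintype.prod_sum_type, Sum.elim_inl, Sum.elim_inr, hp]
      rfl
    have hl : ∀ x y : Fin (2 ^ n) → Bool, ∀ k : Fin (2 ^ n), ∀ h,
        Sum.elim x y ((blockSplit n).symm ⟨k.1, h⟩) = x k := by
      intro x y k h
      have : (⟨k.1, h⟩ : Fin (2 ^ (n + 1))) = blockSplit n (Sum.inl k) := by
        apply Fin.ext; simp [blockSplit]
      rw [this]; simp
    have hr : ∀ x y : Fin (2 ^ n) → Bool, ∀ k : Fin (2 ^ n), ∀ h,
        Sum.elim x y ((blockSplit n).symm ⟨2 ^ n + k.1, h⟩) = y k := by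
      intro x y k h
      have : (⟨2 ^ n + k.1, h⟩ : Fin (2 ^ (n + 1))) = blockSplit n (Sum.inr k) := by
        apply Fin.ext; simp [blockSplit, add_comm]
      rw [this]; simp
    have h1 : ∑ x, (if E x = true then p x else 0) = synthZ z n (j / 2) := ih (j / 2)
    have h0 : ∑ x, p x = 1 := total n
    rw [sum_bool_blocks]
    simp only [synthErased, hl, hr, hsplit, synthZ]
    by_cases hj : j % 2 = 0
    · simp only [hj, if_true, Bool.or_eq_true]
      have key : ∀ x y, (if E x = true ∨ E y = true then p x * p y else 0) =
          (if E x = true then p x else 0) * p y + p x * (if E y = true then p y else 0)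
            - (if E x = true then p x else 0) * (if E y = true then p y else 0) := by
        intro x y
        by_cases hx : E x = true <;> by_cases hy : E y = true <;> simp [hx, hy]
      change ∑ x, ∑ y, (if E x = true ∨ E y = true then p x * p y else 0) = _
      simp only [key, Finset.sum_add_distrib, Finset.sum_sub_distrib, ← Finset.mul_sum,
        ← Finset.sum_mul, h0, h1]
      ring
    · simp only [hj, if_false, Bool.and_eq_true]
      have key : ∀ x y, (if E x = true ∧ E y = true then p x * p y else 0) =
          (if E x = true then p x else 0) * (if E y = true then p y else 0) := by
        intro x y
        by_cases hx : E x = true <;> by_cases hy : E y = true <;> simp [hx, hy]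
      change ∑ x, ∑ y, (if E x = true ∧ E y = true then p x * p y else 0) = _
      simp only [key, ← Finset.mul_sum, ← Finset.sum_mul, h1]
      ring

lemma PolarCode.blockErr_le_sumErr {z : ℝ} (hz : z ∈ Icc (0 : ℝ) 1) {n : ℕ} (A : PolarCode n) :
    A.blockErr z ≤ A.sumErr z := by
  classical
  rw [PolarCode.blockErr, PolarCode.sumErr]
  simp_rw [← sum_synthErased z n]
  rw [Finset.sum_comm]
  refine Finset.sum_le_sum fun e _ => ?_
  have hw : 0 ≤ ∏ k, (if e k then z else 1 - z) :=
    Finset.prod_nonneg fun k _ => by split_ifs <;> linarith [hz.1, hz.2]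
  have hnn : ∀ i ∈ A, 0 ≤ if synthErased n e i = true then ∏ k, (if e k then z else 1 - z) else 0 :=
    fun i _ => by split_ifs <;> simp [hw]
  split_ifs with h
  · obtain ⟨j, hj, hje⟩ := h
    refine le_trans ?_ (Finset.single_le_sum hnn hj)
    simp [hje]
  · exact Finset.sum_nonneg hnn

/-- The average of 1 - Z over all channels is 1 - z, so the gap is the capacity of the discarded
channels minus what the kept ones lack. -/
lemma PolarCode.gap_eq {z : ℝ} {n : ℕ} (A : PolarCode n) :
    2 ^ n * A.gap z = (∑ j ∈ Aᶜ, (1 - synthZ z n j)) - A.sumErr z := by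
  have h := sum_synthZ (fun y => 1 - y) z n
  rw [polarStep_iterate_one_sub, ← Finset.sum_add_sum_compl A] at h
  have h2 : ∑ j ∈ A, (1 - synthZ z n j) = A.card - A.sumErr z := by
    rw [Finset.sum_sub_distrib]; simp [PolarCode.sumErr]
  have h3 : (2 : ℝ) ^ n ≠ 0 := by positivity
  rw [PolarCode.gap, PolarCode.rate, mul_sub, mul_div_cancel₀ _ h3]
  linarith

/-! ### The functions `(x (1 - x)) ^ α` -/

/-- The function `(x (1 - x)) ^ α`. -/
noncomputable def unitBump (α x : ℝ) : ℝ := (x * (1 - x)) ^ α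

lemma mul_one_sub_mem_unit {x : ℝ} (hx : x ∈ Icc (0 : ℝ) 1) : x * (1 - x) ∈ Icc (0 : ℝ) 1 :=
  ⟨mul_nonneg hx.1 (by linarith [hx.2]), by nlinarith [hx.1, hx.2]⟩

lemma unitBump_nonneg (α : ℝ) {x : ℝ} (hx : x ∈ Icc (0 : ℝ) 1) : 0 ≤ unitBump α x :=
  Real.rpow_nonneg (mul_one_sub_mem_unit hx).1 _

lemma unitBump_le_one {α : ℝ} (hα : 0 ≤ α) {x : ℝ} (hx : x ∈ Icc (0 : ℝ) 1) :
    unitBump α x ≤ 1 :=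
  Real.rpow_le_one (mul_one_sub_mem_unit hx).1 (mul_one_sub_mem_unit hx).2 hα

lemma unitBump_pos (α : ℝ) {x : ℝ} (hx : x ∈ Ioo (0 : ℝ) 1) : 0 < unitBump α x :=
  Real.rpow_pos_of_pos (mul_pos hx.1 (by linarith [hx.2])) _

lemma unitBump_zero {α : ℝ} (hα : 0 < α) : unitBump α 0 = 0 := by
  simp [unitBump, Real.zero_rpow hα.ne']

lemma unitBump_one {α : ℝ} (hα : 0 < α) : unitBump α 1 = 0 := by
  simp [unitBump, Real.zero_rpow hα.ne']

lemma continuous_unitBump {α : ℝ} (hα : 0 ≤ α) : Continuous (unitBump α) :=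
  Continuous.rpow_const (by fun_prop) fun _ => Or.inr hα

lemma polarStep_unitBump (α : ℝ) {x : ℝ} (hx : x ∈ Icc (0 : ℝ) 1) :
    polarStep (unitBump α) x =
      ((x * (1 + x)) ^ α + ((2 - x) * (1 - x)) ^ α) / 2 * unitBump α x := by
  have h0 := (mul_one_sub_mem_unit hx).1
  have h1 : 0 ≤ x * (1 + x) := mul_nonneg hx.1 (by linarith [hx.1])
  have h2 : 0 ≤ (2 - x) * (1 - x) := mul_nonneg (by linarith [hx.2]) (by linarith [hx.2])
  rw [polarStep, unitBump, unitBump, unitBump,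
    show x ^ 2 * (1 - x ^ 2) = x * (1 + x) * (x * (1 - x)) by ring,
    show (2 * x - x ^ 2) * (1 - (2 * x - x ^ 2)) = (2 - x) * (1 - x) * (x * (1 - x)) by ring,
    Real.mul_rpow h1 h0, Real.mul_rpow h2 h0]
  ring

lemma polarStep_le_one {φ : ℝ → ℝ} (h : ∀ x ∈ Icc (0 : ℝ) 1, φ x ≤ 1) {x : ℝ}
    (hx : x ∈ Icc (0 : ℝ) 1) : polarStep φ x ≤ 1 := by
  rw [polarStep]
  linarith [h _ (sq_mem_unit hx), h _ (two_mul_sub_sq_mem_unit hx)]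

/-- By `polarStep_unitBump`, T multiplies (x(1-x))^α by a continuous factor symmetric under x ↦ 1 -
x, whose value at 0 is 2^(α-1). -/
lemma exists_polarStep_unitBump_le {α κ : ℝ} (hα : 0 < α) (hκ : (2 : ℝ) ^ (α - 1) < κ) :
    ∃ a : ℝ, 0 < a ∧ a < 1 / 2 ∧ ∀ x ∈ Icc (0 : ℝ) 1, (x ≤ a ∨ 1 - a ≤ x) →
      polarStep (unitBump α) x ≤ κ * unitBump α x := by
  set R : ℝ → ℝ := fun x => ((x * (1 + x)) ^ α + ((2 - x) * (1 - x)) ^ α) / 2 with hR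
  have hRc : Continuous R := by
    apply Continuous.div_const
    exact (Continuous.rpow_const (by fun_prop) fun _ => Or.inr hα.le).add
      (Continuous.rpow_const (by fun_prop) fun _ => Or.inr hα.le)
  have hval : R 0 < κ := by
    simp only [hR]
    rw [Real.rpow_sub_one two_ne_zero] at hκ
    simpa [Real.zero_rpow hα.ne'] using hκ
  have hsymm : ∀ x, R (1 - x) = R x := by
    intro x
    simp only [hR]
    rw [show (1 - x) * (1 + (1 - x)) = (2 - x) * (1 - x) by ring,
      show (2 - (1 - x)) * (1 - (1 - x)) = x * (1 + x) by ring, add_comm]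
  obtain ⟨d, hd, hdR⟩ := Metric.eventually_nhds_iff.1 (hRc.continuousAt.eventually_lt_const hval)
  have key : ∀ x, 0 ≤ x → x ≤ min (d / 2) (1 / 4) → R x ≤ κ := by
    intro x h0 h1
    refine (hdR ?_).le
    rw [Real.dist_eq, sub_zero, abs_of_nonneg h0]
    linarith [min_le_left (d / 2) (1 / 4)]
  refine ⟨min (d / 2) (1 / 4), by positivity, by linarith [min_le_right (d / 2) (1 / 4)], ?_⟩
  intro x hx h
  rw [polarStep_unitBump α hx]
  refine mul_le_mul_of_nonneg_right ?_ (unitBump_nonneg α hx)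
  rcases h with h | h
  · exact key x hx.1 h
  · have := key (1 - x) (by linarith [hx.2]) (by linarith)
    rwa [hsymm] at this

/-! ### Large deviations of the number of squarings -/

/-- The Chernoff exponent log(1+θ) - p log θ is minimal in θ where p = θ/(1+θ), with the entropy of
p as its minimum. This turns (2) into a statement about θ. -/
lemma binEntropy_div_one_add {θ : ℝ} (hθ : 0 < θ) :
    Real.binEntropy (θ / (1 + θ)) = Real.log (1 + θ) - θ / (1 + θ) * Real.log θ := by
  have h1 : 0 < 1 + θ := by linarith
  have h2 : 1 - θ / (1 + θ) = (1 + θ)⁻¹ := by field_simp; ring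
  rw [Real.binEntropy, h2, inv_inv, Real.log_inv, Real.log_div hθ.ne' h1.ne']
  field_simp
  ring

lemma exists_tilt {μ : ℝ} (hμ : 0 < μ) (h : NumericCondition μ) :
    ∃ θ : ℝ, 0 < θ ∧ θ < 1 ∧ (1 + θ) / 2 < (2 : ℝ) ^ (-1 / μ) ∧
      θ ^ (-0.4469 : ℝ) * ((1 + θ) / 2) ≤ 1 := by
  have hl : 0 < Real.log 2 := Real.log_pos one_lt_two
  have hμ1 : 1 / μ < 1 := by
    have := h 0 (by norm_num)
    simpa [H2] using this
  suffices hs : ∃ θ : ℝ, 0 < θ ∧ θ < 1 ∧ Real.log (1 + θ) < Real.log 2 * (1 - 1 / μ) ∧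
      Real.log (1 + θ) - 0.4469 * Real.log θ < Real.log 2 by
    obtain ⟨θ, h0, h1, h2, h3⟩ := hs
    have hp : 0 < 1 + θ := by linarith
    refine ⟨θ, h0, h1, ?_, ?_⟩
    · rw [← Real.log_lt_log_iff (by positivity) (by positivity), Real.log_rpow two_pos,
        Real.log_div hp.ne' two_ne_zero]
      have : -1 / μ * Real.log 2 = -(Real.log 2 * (1 / μ)) := by ring
      rw [this]; linarith
    · have hpos : 0 < θ ^ (-0.4469 : ℝ) := Real.rpow_pos_of_pos h0 _
      rw [← Real.log_nonpos_iff (by positivity), Real.log_mul hpos.ne' (by positivity),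
        Real.log_rpow h0, Real.log_div hp.ne' two_ne_zero]
      linarith
  -- The borderline tilt, at which (1+θ)/2 = 2^(-1/μ).
  set θ₀ : ℝ := (2 : ℝ) ^ (1 - 1 / μ) - 1 with hθ₀
  have h0 : 0 < θ₀ := by
    have := Real.one_lt_rpow one_lt_two (show 0 < 1 - 1 / μ by linarith)
    rw [hθ₀]; linarith
  have h1 : θ₀ < 1 := by
    have := Real.rpow_lt_rpow_of_exponent_lt one_lt_two
      (show 1 - 1 / μ < 1 by linarith [one_div_pos.2 hμ])
    rw [Real.rpow_one] at this
    rw [hθ₀]; linarith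
  have hlog : Real.log (1 + θ₀) = Real.log 2 * (1 - 1 / μ) := by
    rw [hθ₀, add_sub_cancel, Real.log_rpow two_pos, mul_comm]
  rcases le_or_gt (θ₀ / (1 + θ₀)) 0.4469 with hc | hc
  · set p := θ₀ / (1 + θ₀) with hp
    have hp0 : 0 < p := by positivity
    -- At this ξ the entropy in (2) is the Chernoff exponent of θ₀, and clearing the factor p/0.4469
    -- leaves the second inequality, strict at θ₀. Strictness allows a move to θ slightly below θ₀.
    have hx := h (p / 0.4469) ⟨by positivity, by rw [div_le_one (by norm_num)]; exact hc⟩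
    rw [mul_div_cancel₀ _ (by norm_num), H2, hp, binEntropy_div_one_add h0, ← hp, hlog] at hx
    have hx2 : (1 - p / 0.4469) / μ * Real.log 2 +
        (Real.log 2 * (1 - 1 / μ) - p * Real.log θ₀) < Real.log 2 := by
      have := mul_lt_mul_of_pos_right hx hl
      rwa [add_mul, div_mul_cancel₀ _ hl.ne', one_mul] at this
    have hlt : Real.log (1 + θ₀) - 0.4469 * Real.log θ₀ < Real.log 2 := by
      rw [hlog]
      have h5 : p * (-(Real.log 2 / μ) - 0.4469 * Real.log θ₀) < 0 := by
        have e : p * (-(Real.log 2 / μ) - 0.4469 * Real.log θ₀) =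
          0.4469 * ((1 - p / 0.4469) / μ * Real.log 2 +
            (Real.log 2 * (1 - 1 / μ) - p * Real.log θ₀) - Real.log 2) := by
          field_simp; ring
        rw [e]; linarith
      have h6 := neg_of_mul_neg_right h5 hp0.le
      have e2 : Real.log 2 * (1 - 1 / μ) = Real.log 2 - Real.log 2 / μ := by ring
      linarith
    have hc1 : ContinuousAt (fun θ => Real.log (1 + θ) - 0.4469 * Real.log θ) θ₀ := by
      have e1 : (1 : ℝ) + θ₀ ≠ 0 := by positivity
      have e2 : θ₀ ≠ 0 := h0.ne'
      fun_prop (disch := assumption)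
    have ev : ∀ᶠ θ in 𝓝[<] θ₀, Real.log (1 + θ) - 0.4469 * Real.log θ < Real.log 2 :=
      (hc1.eventually_lt_const hlt).filter_mono nhdsWithin_le_nhds
    have ev2 : ∀ᶠ θ in 𝓝[<] θ₀, 0 < θ :=
      (eventually_gt_nhds h0).filter_mono nhdsWithin_le_nhds
    obtain ⟨θ, h7, h8, h9⟩ := (ev.and (ev2.and self_mem_nhdsWithin)).exists
    have h9 : θ < θ₀ := h9
    refine ⟨θ, h8, by linarith, ?_, h7⟩
    rw [← hlog]
    exact Real.log_lt_log (by linarith) (by linarith)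
  -- Here the optimal tilt for p = 0.4469, namely its odds 4469/5531, lies below θ₀, and ξ = 1 in
  -- (2) suffices.
  · have e1 : (4469 / 5531 : ℝ) / (1 + 4469 / 5531) = 0.4469 := by norm_num
    have hlt : (4469 / 5531 : ℝ) < θ₀ := by
      rw [lt_div_iff₀ (by linarith)] at hc
      linarith
    refine ⟨4469 / 5531, by norm_num, by norm_num, ?_, ?_⟩
    · rw [← hlog]
      exact Real.log_lt_log (by norm_num) (by linarith)
    · have hx := h 1 (by norm_num)
      rw [mul_one, ← e1, H2, binEntropy_div_one_add (by norm_num), e1] at hx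
      simp only [sub_self, zero_div, zero_add] at hx
      rwa [div_lt_one hl] at hx

/-- A Chernoff bound: each squaring is weighted by θ, and K squarings suffice. A squaring turns (s,
K) into (2s, K-1) without changing ε; the other branch at most doubles x, which costs one of the N+1
units in the exponent because s ≥ 1. -/
lemma polarStep_iterate_indicator_le {θ ε : ℝ} (h0 : 0 < θ) (h1 : θ ≤ 1) (N : ℕ) :
    ∀ s K x : ℝ, 1 ≤ s → ε = 2 ^ (-(s * 2 ^ K)) → x ∈ Icc (0 : ℝ) 1 →
      x ≤ 2 ^ (-(s * (N + 1))) →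
      polarStep^[N] (fun y => if ε < y then 1 else 0) x ≤ ((1 + θ) / 2) ^ N * θ ^ (-K) := by
  induction N with
  | zero =>
    intro s K x hs hε hx hxs
    have hpos : 0 < θ ^ (-K) := Real.rpow_pos_of_pos h0 _
    simp only [Function.iterate_zero, id_eq, pow_zero, one_mul]
    split_ifs with hlt
    -- With no steps left, K ≤ 0 would already give x ≤ ε; so K > 0 and the claimed bound is at
    -- least 1.
    · rcases le_or_gt K 0 with hK | hK
      · exfalso
        refine absurd hlt (not_lt.2 (hxs.trans ?_))
        rw [hε]
        apply Real.rpow_le_rpow_of_exponent_le one_le_two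
        have := Real.rpow_le_one_of_one_le_of_nonpos (one_le_two (α := ℝ)) hK
        push_cast
        nlinarith
      · exact Real.one_le_rpow_of_pos_of_le_one_of_nonpos h0 h1 (by linarith)
    · exact hpos.le
  | succ N ih =>
    intro s K x hs hε hx hxs
    have hs0 : 0 < s := by linarith
    have hA := ih (2 * s) (K - 1) (x ^ 2) (by linarith)
      (by rw [hε, Real.rpow_sub_one two_ne_zero]; congr 2; ring) (sq_mem_unit hx) (by
        calc x ^ 2 ≤ (2 ^ (-(s * ((N + 1 : ℕ) + 1))) : ℝ) ^ 2 := by gcongr; exact hx.1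
          _ = (2 : ℝ) ^ (-(s * ((N + 1 : ℕ) + 1)) * 2) := by
            rw [Real.rpow_mul two_pos.le]; norm_num
          _ ≤ _ := by
            apply Real.rpow_le_rpow_of_exponent_le one_le_two
            push_cast; nlinarith)
    have hB := ih s K (2 * x - x ^ 2) hs hε (two_mul_sub_sq_mem_unit hx) (by
        calc 2 * x - x ^ 2 ≤ (2 : ℝ) ^ (-(s * ((N + 1 : ℕ) + 1))) * 2 := by nlinarith
          _ = (2 : ℝ) ^ (-(s * ((N + 1 : ℕ) + 1)) + 1) := by
            rw [Real.rpow_add_one two_ne_zero]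
          _ ≤ _ := by
            apply Real.rpow_le_rpow_of_exponent_le one_le_two
            push_cast; nlinarith)
    rw [polarStep_iterate_succ]
    have e : θ ^ (-(K - 1)) = θ ^ (-K) * θ := by
      rw [← Real.rpow_add_one h0.ne']; congr 1; ring
    rw [e] at hA
    rw [pow_succ ((1 + θ) / 2)]
    linarith

/-! ### Polarization speed -/

/-- A certifying h may decay arbitrarily fast at the ends, so a multiple of it is added to
(x(1-x))^α. Near the ends this bump contracts by about 2^(α-1) < ρ; in the middle the slack (ρ -
r)h, scaled to be at least 1, absorbs its growth. A small α keeps the later loss 2^(αn) below the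
gain from ρ < 2^(-1/μ*). -/
lemma exists_dominating_eigenfunction {h : ℝ → ℝ} {μs γ b : ℝ} (hh : EigenCriterion h μs)
    (hγ : γ < 1) (hb : b < (2 : ℝ) ^ (-1 / μs)) :
    ∃ (ρ α C : ℝ) (ψ : ℝ → ℝ), 0 < ρ ∧ ρ < 1 ∧ b ≤ ρ ∧ 0 < α ∧
      (2 : ℝ) ^ α * ρ ^ (1 - γ) < ((2 : ℝ) ^ (-1 / μs)) ^ (1 - γ) ∧
      ∀ x ∈ Icc (0 : ℝ) 1, unitBump α x ≤ ψ x ∧ ψ x ≤ C ∧ polarStep ψ x ≤ ρ * ψ x := by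
  obtain ⟨r, hr, hrat⟩ := hh.sup_lt
  have hμs : 0 < μs := by linarith [hh.two_lt]
  have hhalf : (1 / 2 : ℝ) < 2 ^ (-1 / μs) := by
    rw [show (1 / 2 : ℝ) = 2 ^ (-1 : ℝ) by rw [Real.rpow_neg_one]; norm_num]
    apply Real.rpow_lt_rpow_of_exponent_lt one_lt_two
    rw [lt_div_iff₀ hμs]; linarith [hh.two_lt]
  obtain ⟨ρ, hρ1, hρ2⟩ := exists_between (max_lt (max_lt hr hb) hhalf)
  simp only [max_lt_iff] at hρ1
  obtain ⟨⟨hrρ, hbρ⟩, hρh⟩ := hρ1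
  have hρ0 : 0 < ρ := by linarith
  have hw1 : (2 : ℝ) ^ (-1 / μs) < 1 :=
    Real.rpow_lt_one_of_one_lt_of_neg one_lt_two (div_neg_of_neg_of_pos (by norm_num) hμs)
  have ev1 : ∀ᶠ α : ℝ in 𝓝[>] 0, (2 : ℝ) ^ (α - 1) < ρ := by
    have hc : ContinuousAt (fun α : ℝ => (2 : ℝ) ^ (α - 1)) 0 :=
      (Continuous.rpow (by fun_prop) (by fun_prop) fun _ => Or.inl two_ne_zero).continuousAt
    refine (hc.eventually_lt_const ?_).filter_mono nhdsWithin_le_nhds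
    simp only [zero_sub, Real.rpow_neg_one]; linarith
  have ev2 : ∀ᶠ α : ℝ in 𝓝[>] 0,
      (2 : ℝ) ^ α * ρ ^ (1 - γ) < ((2 : ℝ) ^ (-1 / μs)) ^ (1 - γ) := by
    have hc : ContinuousAt (fun α : ℝ => (2 : ℝ) ^ α * ρ ^ (1 - γ)) 0 :=
      ((Continuous.rpow (by fun_prop) (by fun_prop) fun _ => Or.inl two_ne_zero).mul
        continuous_const).continuousAt
    refine (hc.eventually_lt_const ?_).filter_mono nhdsWithin_le_nhds
    simp only [Real.rpow_zero, one_mul]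
    exact Real.rpow_lt_rpow hρ0.le hρ2 (by linarith)
  obtain ⟨α, hα1, hα2, hα⟩ := (ev1.and (ev2.and self_mem_nhdsWithin)).exists
  have hα : 0 < α := hα
  obtain ⟨a, ha0, ha1, hend⟩ := exists_polarStep_unitBump_le hα hα1
  obtain ⟨c, hc, hcb⟩ := hh.bddBelow a (1 - a) ha0 (by linarith)
  have hδ : 0 < (ρ - r) * c := mul_pos (by linarith) hc
  have hstep : ∀ x ∈ Icc (0 : ℝ) 1, polarStep h x ≤ r * h x := by
    intro x hx
    rcases eq_or_lt_of_le hx.1 with h0 | h0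
    · subst h0; simp [polarStep, hh.zero]
    rcases eq_or_lt_of_le hx.2 with h1 | h1
    · subst h1; norm_num [polarStep, hh.one]
    obtain ⟨c', hc', hcb'⟩ := hh.bddBelow x x h0 h1
    have hpos : 0 < h x := lt_of_lt_of_le hc' (hcb' x ⟨le_rfl, le_rfl⟩)
    have := hrat x ⟨h0, h1⟩
    rw [div_le_iff₀ (by positivity)] at this
    rw [polarStep]; linarith
  refine ⟨ρ, α, 1 / ((ρ - r) * c) + 1, fun x => h x / ((ρ - r) * c) + unitBump α x, hρ0,
    by linarith, hbρ.le, hα, hα2, ?_⟩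
  intro x hx
  have hmap := hh.mapsTo hx
  refine ⟨?_, ?_, ?_⟩
  · have := div_nonneg hmap.1 hδ.le
    linarith
  · have h1 := unitBump_le_one hα.le hx
    have h2 : h x / ((ρ - r) * c) ≤ 1 / ((ρ - r) * c) := by gcongr; exact hmap.2
    linarith
  · have e : polarStep (fun x => h x / ((ρ - r) * c) + unitBump α x) x =
        polarStep h x / ((ρ - r) * c) + polarStep (unitBump α) x := by
      simp only [polarStep]; ring
    have h1 : polarStep h x / ((ρ - r) * c) ≤ r * h x / ((ρ - r) * c) := by
      gcongr; exact hstep x hx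
    rw [e]
    by_cases hxa : x ≤ a ∨ 1 - a ≤ x
    · have h2 := hend x hx hxa
      have h3 : r * h x / ((ρ - r) * c) ≤ ρ * (h x / ((ρ - r) * c)) := by
        rw [← mul_div_assoc]
        gcongr
        exact hmap.1
      linarith
    · push Not at hxa
      have h2 := polarStep_le_one (fun y hy => unitBump_le_one hα.le hy) hx (φ := unitBump α)
      have h3 : 1 ≤ (ρ - r) * h x / ((ρ - r) * c) := by
        rw [one_le_div hδ]
        exact mul_le_mul_of_nonneg_left (hcb x ⟨hxa.1.le, hxa.2.le⟩) (by linarith)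
      have h4 := mul_nonneg hρ0.le (unitBump_nonneg α hx)
      have h5 : (ρ - r) * h x / ((ρ - r) * c) =
        ρ * (h x / ((ρ - r) * c)) - r * h x / ((ρ - r) * c) := by ring
      linarith

/-- First-passage decomposition: `x ≤ τ` is the region from which the process is known to end
well, `m` is the number of steps during which it may enter that region. -/
lemma polarStep_iterate_first_passage {Φ ψ : ℝ → ℝ} {τ η G ρ : ℝ} {r T : ℕ} (hρ : 0 < ρ)
    (hη : 0 ≤ η) (hG : 0 ≤ G) (hψ0 : ∀ x ∈ Icc (0 : ℝ) 1, 0 ≤ ψ x)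
    (hψ : ∀ x ∈ Icc (0 : ℝ) 1, polarStep ψ x ≤ ρ * ψ x)
    (hB : ∀ m ≤ T, ∀ x ∈ Icc (0 : ℝ) 1, x ≤ τ → polarStep^[r + m] Φ x ≤ ρ ^ m)
    (h0 : ∀ x ∈ Icc (0 : ℝ) 1, τ < x → polarStep^[r] Φ x ≤ η + G * ψ x)
    (henter : ∀ x ∈ Icc (0 : ℝ) 1, τ < x → x ^ 2 ≤ τ → 1 ≤ G * ψ x) (m : ℕ) (hm : m ≤ T) :
    ∀ x ∈ Icc (0 : ℝ) 1, polarStep^[r + m] Φ x ≤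
      η + G * (1 + m / ρ) * ρ ^ m * ψ x + (if x ≤ τ then ρ ^ m else 0) := by
  induction m with
  | zero =>
    intro x hx
    have h1 := mul_nonneg hG (hψ0 x hx)
    split_ifs with h
    · have := hB 0 hm x hx h
      simp only [Nat.cast_zero, zero_div, add_zero, mul_one, pow_zero] at this ⊢
      linarith
    · have := h0 x hx (not_le.1 h)
      simp only [Nat.cast_zero, zero_div, add_zero, mul_one, pow_zero]
      linarith
  | succ m ih =>
    intro x hx
    have hcoef : 0 ≤ G * (1 + m / ρ) * ρ ^ m := by positivity
    split_ifs with h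
    · have h1 := hB (m + 1) hm x hx h
      have h2 : 0 ≤ G * (1 + (m + 1 : ℕ) / ρ) * ρ ^ (m + 1) * ψ x :=
        mul_nonneg (by positivity) (hψ0 x hx)
      linarith
    · have hlt := not_le.1 h
      have hA := ih (by omega) _ (sq_mem_unit hx)
      have hC := ih (by omega) _ (two_mul_sub_sq_mem_unit hx)
      -- Only a squaring can cross τ downwards.
      have hnot : ¬ 2 * x - x ^ 2 ≤ τ := by
        have : x ≤ 2 * x - x ^ 2 := by nlinarith [hx.1, hx.2]
        linarith
      rw [if_neg hnot] at hC
      have hind : (if x ^ 2 ≤ τ then ρ ^ m else 0) ≤ ρ ^ m * (G * ψ x) := by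
        split_ifs with h2
        · exact le_mul_of_one_le_right (by positivity) (henter x hx hlt h2)
        · exact mul_nonneg (by positivity) (mul_nonneg hG (hψ0 x hx))
      have hst := mul_le_mul_of_nonneg_left (hψ x hx) hcoef
      rw [polarStep] at hst
      -- An entry contributes ρ^m, which G ψ x pays for; relative to ρ^(m+1) each step thus adds 1/ρ
      -- to the coefficient.
      have e : G * (1 + (m + 1 : ℕ) / ρ) * ρ ^ (m + 1) * ψ x =
          G * (1 + m / ρ) * ρ ^ m * (ρ * ψ x) + ρ ^ m * (G * ψ x) := by
        push_cast; field_simp; ring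
      have hnn : 0 ≤ ρ ^ m * (G * ψ x) :=
        mul_nonneg (by positivity) (mul_nonneg hG (hψ0 x hx))
      rw [e, ← add_assoc r m 1, polarStep_iterate_succ]
      linarith

lemma exists_add_one_mul_pow_le {t : ℝ} (h0 : 0 ≤ t) (h1 : t < 1) (b : ℝ) :
    ∃ C : ℝ, 0 ≤ C ∧ ∀ n : ℕ, (1 + n * b) * t ^ n ≤ C := by
  have h2 : Tendsto (fun n : ℕ => (1 + n * b) * t ^ n) atTop (𝓝 (0 + b * 0)) := by
    have ha := tendsto_pow_atTop_nhds_zero_of_lt_one h0 h1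
    have hb := (tendsto_self_mul_const_pow_of_lt_one h0 h1).const_mul b
    exact (ha.add hb).congr fun n => by ring
  obtain ⟨C, hC⟩ := h2.bddAbove_range
  exact ⟨max C 0, le_max_right _ _, fun n => (hC ⟨n, rfl⟩).trans (le_max_left _ _)⟩

set_option maxHeartbeats 1000000 in
-- First passage below τ, with ψ governing the time before it and the Chernoff bound the time after
-- it. Both lose at most ρ per step, so the entry time costs only a linear factor, absorbed together
-- with 2^(αn) by q < w.
lemma exists_tail_bound {h : ℝ → ℝ} {μ μs γ : ℝ} (hμ : 0 < μ) (hnum : NumericCondition μ)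
    (hle : μ ≤ μs) (hh : EigenCriterion h μs) (hγ : γ ∈ Ioo (0 : ℝ) 1) :
    ∃ C : ℝ, ∀ n : ℕ, ∀ x ∈ Icc (0 : ℝ) 1,
      polarStep^[n] (fun y => if (2 : ℝ) ^ (-(2 : ℝ) ^ (0.4469 * γ * n)) < y then 1 - y else 0) x
        ≤ C * (((2 : ℝ) ^ (-1 / μs)) ^ (1 - γ)) ^ n := by
  obtain ⟨hγ0, hγ1⟩ := hγ
  have hμs : 0 < μs := by linarith
  obtain ⟨θ, hθ0, hθ1, hσμ, hθσ⟩ := exists_tilt hμ hnum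
  set σ := (1 + θ) / 2 with hσ
  have hσ0 : 0 < σ := by positivity
  have hσ1 : σ < 1 := by rw [hσ]; linarith
  have hb : σ < (2 : ℝ) ^ (-1 / μs) := by
    refine hσμ.trans_le (Real.rpow_le_rpow_of_exponent_le one_le_two ?_)
    rw [neg_div, neg_div, neg_le_neg_iff]
    exact one_div_le_one_div_of_le hμ hle
  obtain ⟨ρ, α, M, ψ, hρ0, hρ1, hσρ, hα, hq, hψ⟩ := exists_dominating_eigenfunction hh hγ1 hb
  set w : ℝ := ((2 : ℝ) ^ (-1 / μs)) ^ (1 - γ) with hw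
  have hw0 : 0 < w := by positivity
  set q : ℝ := (2 : ℝ) ^ α * ρ ^ (1 - γ) with hq'
  have hq0 : 0 < q := by positivity
  have hhalfw : (2 : ℝ)⁻¹ ≤ w := by
    rw [hw, ← Real.rpow_mul two_pos.le, ← Real.rpow_neg_one]
    apply Real.rpow_le_rpow_of_exponent_le one_le_two
    have h1 : 1 / μs ≤ 1 := by rw [div_le_one hμs]; linarith [hh.two_lt]
    have h2 : 0 < 1 / μs := by positivity
    have : -1 / μs * (1 - γ) = -(1 / μs) * (1 - γ) := by ring
    rw [this]; nlinarith
  have hψ0 : ∀ x ∈ Icc (0 : ℝ) 1, 0 ≤ ψ x := fun x hx => (unitBump_nonneg α hx).trans (hψ x hx).1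
  have hM0 : 0 ≤ M := (hψ0 0 (by simp)).trans (hψ 0 (by simp)).2.1
  obtain ⟨K, hK0, hK⟩ := exists_add_one_mul_pow_le (t := q / w) (by positivity)
    ((div_lt_one hw0).2 hq) (1 / ρ)
  have hqw : ∀ n : ℕ, (1 + n / ρ) * q ^ n ≤ K * w ^ n := by
    intro n
    have := hK n
    rwa [div_pow, mul_div_assoc', div_le_iff₀ (by positivity), mul_one_div] at this
  refine ⟨1 + (2 : ℝ) ^ (3 * α) * ρ⁻¹ * M * K + ρ⁻¹ * K, fun n x hx => ?_⟩
  set ε : ℝ := (2 : ℝ) ^ (-(2 : ℝ) ^ (0.4469 * γ * n)) with hε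
  set Φ : ℝ → ℝ := fun y => if ε < y then 1 - y else 0 with hΦ
  -- Small enough to survive n doublings, yet so large that ψ is at least 2^(-α(n+3)) on [τ, 1-τ].
  set τ : ℝ := (2 : ℝ) ^ (-((n : ℝ) + 2)) with hτ
  -- The other r = n - T ≥ γn steps are reserved to pay for the squarings.
  set T := ⌊(1 - γ) * n⌋₊ with hT
  have hTle : (T : ℝ) ≤ (1 - γ) * n :=
    Nat.floor_le (mul_nonneg (by linarith) (Nat.cast_nonneg n))
  have hTge : (1 - γ) * n - 1 ≤ T := by linarith [Nat.lt_floor_add_one ((1 - γ) * (n : ℝ))]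
  have hTn : T ≤ n := by
    have : (T : ℝ) ≤ n := hTle.trans (by nlinarith [Nat.cast_nonneg (α := ℝ) n])
    exact_mod_cast this
  obtain ⟨r, hr⟩ := Nat.exists_eq_add_of_le' hTn
  have hrn : γ * n ≤ r := by
    have : (n : ℝ) = r + T := by rw [← Nat.cast_add, ← hr]
    linarith
  set G : ℝ := (2 : ℝ) ^ (α * (n + 3)) with hG
  have hG0 : 0 < G := by positivity
  have hτ0 : 0 < τ := by positivity
  have hτ1 : τ ≤ 1 / 4 := by
    rw [hτ, show (1 / 4 : ℝ) = 2 ^ (-2 : ℝ) by rw [Real.rpow_neg two_pos.le]; norm_num]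
    exact Real.rpow_le_rpow_of_exponent_le one_le_two
      (by linarith [Nat.cast_nonneg (α := ℝ) n])
  have hbump : ∀ y ∈ Icc (0 : ℝ) 1, τ ≤ y → τ ≤ 1 - y → 1 ≤ G * ψ y := by
    intro y hy h1 h2
    have h3 : (2 : ℝ) ^ (-((n : ℝ) + 3)) ≤ y * (1 - y) := by
      have e : (2 : ℝ) ^ (-((n : ℝ) + 3)) = τ * (1 / 2) := by
        rw [hτ, show -((n : ℝ) + 3) = -((n : ℝ) + 2) - 1 by ring, Real.rpow_sub_one two_ne_zero]
        ring
      rw [e]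
      rcases le_total y (1 / 2) with hc | hc
      · exact mul_le_mul h1 (by linarith) (by norm_num) hy.1
      · rw [mul_comm y]; exact mul_le_mul h2 hc (by norm_num) (by linarith [hy.2])
    have h4 := Real.rpow_le_rpow (by positivity) h3 hα.le
    rw [← Real.rpow_mul two_pos.le] at h4
    have h5 : 1 = G * (2 : ℝ) ^ (-((n : ℝ) + 3) * α) := by
      rw [hG, ← Real.rpow_add two_pos, ← Real.rpow_zero (2 : ℝ)]; congr 1; ring
    rw [h5]
    exact mul_le_mul_of_nonneg_left (h4.trans (hψ y hy).1) hG0.le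
  have hΦ1 : ∀ y ∈ Icc (0 : ℝ) 1, Φ y ≤ 1 - y := by
    intro y hy
    simp only [hΦ]
    split_ifs
    · exact le_rfl
    · linarith [hy.2]
  -- The term η covers points within τ of 1, where ψ may be tiny: there Φ ≤ 1 - y and the martingale
  -- property bound the expectation by 1 - y < 2^(-n).
  have hmain := polarStep_iterate_first_passage (Φ := Φ) (ψ := ψ) (τ := τ) (η := (2⁻¹ : ℝ) ^ n)
    (G := G) (ρ := ρ) (r := r) (T := T) hρ0 (by positivity) hG0.le hψ0
    (fun y hy => (hψ y hy).2.2) ?_ ?_ ?_ T le_rfl x hx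
  · rw [← hr] at hmain
    have hρT : ρ ^ T ≤ ρ⁻¹ * (ρ ^ (1 - γ)) ^ n := by
      rw [← Real.rpow_natCast ρ T, ← Real.rpow_mul_natCast hρ0.le, ← Real.rpow_neg_one ρ,
        ← Real.rpow_add hρ0]
      exact Real.rpow_le_rpow_of_exponent_ge hρ0 hρ1.le (by linarith)
    have hGρ : G * (ρ ^ (1 - γ)) ^ n = (2 : ℝ) ^ (3 * α) * q ^ n := by
      rw [hG, hq', mul_pow, ← Real.rpow_mul_natCast two_pos.le, ← mul_assoc,
        ← Real.rpow_add two_pos]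
      congr 2; ring
    have h1 : (2⁻¹ : ℝ) ^ n ≤ w ^ n := pow_le_pow_left₀ (by norm_num) hhalfw n
    have h2 : G * (1 + T / ρ) * ρ ^ T * ψ x ≤
        (2 : ℝ) ^ (3 * α) * ρ⁻¹ * M * K * w ^ n := by
      calc G * (1 + T / ρ) * ρ ^ T * ψ x
          ≤ G * (1 + n / ρ) * (ρ⁻¹ * (ρ ^ (1 - γ)) ^ n) * M := by
            gcongr
            · exact hψ0 x hx
            · exact (hψ x hx).2.1
        _ = (2 : ℝ) ^ (3 * α) * ρ⁻¹ * M * ((1 + n / ρ) * q ^ n) := by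
            rw [show G * (1 + n / ρ) * (ρ⁻¹ * (ρ ^ (1 - γ)) ^ n) * M =
              (G * (ρ ^ (1 - γ)) ^ n) * ((1 + n / ρ) * ρ⁻¹ * M) by ring, hGρ]
            ring
        _ ≤ (2 : ℝ) ^ (3 * α) * ρ⁻¹ * M * (K * w ^ n) := by
            exact mul_le_mul_of_nonneg_left (hqw n) (by positivity)
        _ = _ := by ring
    have h3 : (if x ≤ τ then ρ ^ T else 0) ≤ ρ⁻¹ * K * w ^ n := by
      have h4 : (if x ≤ τ then ρ ^ T else 0) ≤ ρ ^ T := by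
        split_ifs
        · exact le_rfl
        · positivity
      have h5 : (ρ ^ (1 - γ)) ^ n ≤ q ^ n := by
        refine pow_le_pow_left₀ (by positivity) ?_ n
        rw [hq']
        exact le_mul_of_one_le_left (by positivity) (Real.one_le_rpow one_le_two hα.le)
      have h6 : q ^ n ≤ K * w ^ n := by
        refine le_trans ?_ (hqw n)
        refine le_mul_of_one_le_left (by positivity) ?_
        have : 0 ≤ (n : ℝ) / ρ := by positivity
        linarith
      calc _ ≤ ρ⁻¹ * (ρ ^ (1 - γ)) ^ n := h4.trans hρT
        _ ≤ ρ⁻¹ * (K * w ^ n) := by gcongr; exact h5.trans h6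
        _ = _ := by ring
    calc _ ≤ _ := hmain
      _ ≤ w ^ n + (2 : ℝ) ^ (3 * α) * ρ⁻¹ * M * K * w ^ n + ρ⁻¹ * K * w ^ n := by
        gcongr
      _ = _ := by ring
  · intro m hm y hy hyτ
    have h1 := polarStep_iterate_indicator_le (ε := ε) hθ0 hθ1.le (r + m) 1 (0.4469 * γ * n) y le_rfl
      (by rw [hε, one_mul]) hy (hyτ.trans (by
        rw [hτ]
        apply Real.rpow_le_rpow_of_exponent_le one_le_two
        have : ((r + m : ℕ) : ℝ) ≤ n := by exact_mod_cast (by omega : r + m ≤ n)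
        linarith))
    have h2 : polarStep^[r + m] Φ y ≤ polarStep^[r + m] (fun y => if ε < y then 1 else 0) y := by
      refine polarStep_iterate_mono (fun v hv => ?_) _ y hy
      simp only [hΦ]
      split_ifs
      · linarith [hv.1]
      · exact le_rfl
    -- The reserved steps pay in full for θ^(-K), leaving σ^m ≤ ρ^m.
    have h3 : σ ^ r * θ ^ (-(0.4469 * γ * n)) ≤ 1 := by
      have e : (θ ^ (-0.4469 : ℝ) * σ) ^ (γ * n) = σ ^ (γ * n) * θ ^ (-(0.4469 * γ * n)) := by
        rw [Real.mul_rpow (by positivity) hσ0.le, ← Real.rpow_mul hθ0.le, mul_comm]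
        congr 2; ring
      have h4 : σ ^ r ≤ σ ^ (γ * n) := by
        rw [← Real.rpow_natCast σ r]
        exact Real.rpow_le_rpow_of_exponent_ge hσ0 hσ1.le hrn
      calc _ ≤ σ ^ (γ * n) * θ ^ (-(0.4469 * γ * n)) := by gcongr
        _ = _ := e.symm
        _ ≤ 1 := Real.rpow_le_one (by positivity) hθσ (by positivity)
    calc _ ≤ σ ^ (r + m) * θ ^ (-(0.4469 * γ * n)) := h2.trans h1
      _ = σ ^ m * (σ ^ r * θ ^ (-(0.4469 * γ * n))) := by ring
      _ ≤ ρ ^ m * 1 := by gcongr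
      _ = _ := mul_one _
  · intro y hy hyτ
    have h1 := polarStep_iterate_mono hΦ1 r y hy
    rw [polarStep_iterate_one_sub] at h1
    refine h1.trans ?_
    have h2 := mul_nonneg hG0.le (hψ0 y hy)
    rcases le_or_gt τ (1 - y) with hc | hc
    · linarith [hbump y hy hyτ.le hc, hy.1, pow_pos (show (0 : ℝ) < 2⁻¹ by norm_num) n]
    · have h3 : τ ≤ (2⁻¹ : ℝ) ^ n := by
        rw [hτ, inv_pow, ← Real.rpow_natCast, ← Real.rpow_neg two_pos.le]
        exact Real.rpow_le_rpow_of_exponent_le one_le_two (by linarith)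
      linarith
  · intro y hy h1 h2
    refine hbump y hy h1.le ?_
    have h3 : y ≤ 1 / 2 := (abs_le_of_sq_le_sq' (b := 1 / 2) (by linarith) (by norm_num)).2
    linarith

/-! ### Exponents of a series of codes -/

lemma eventually_natCast_le_two_rpow {β : ℝ} (hβ : 0 < β) {c : ℝ} (hc : 0 < c) :
    ∀ᶠ n : ℕ in atTop, (n : ℝ) ≤ c * (2 : ℝ) ^ (β * n) := by
  have hb : (2 : ℝ) ^ (-β) < 1 := Real.rpow_lt_one_of_one_lt_of_neg one_lt_two (by linarith)
  have h := tendsto_self_mul_const_pow_of_lt_one (by positivity) hb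
  filter_upwards [h.eventually_lt_const hc] with n hn
  rw [← Real.rpow_mul_natCast two_pos.le, neg_mul, Real.rpow_neg two_pos.le,
    mul_inv_lt_iff₀ (by positivity)] at hn
  exact hn.le

/-- Halving the exponent 2^(βn) absorbs the factor 2^n, and a constant factor disappears after two
logarithms and division by n. -/
lemma le_errorExponent_of_eventually_le {z β : ℝ} (hβ : 0 < β) {A : PolarSeries}
    (h : ∀ᶠ n : ℕ in atTop,
      (A n).blockErr z ≤ (2 : ℝ) ^ n * (2 : ℝ) ^ (-(2 : ℝ) ^ (β * (n : ℝ)))) :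
    (β : EReal) ≤ errorExponent z A := by
  have hl : 0 < Real.log 2 := Real.log_pos one_lt_two
  set c : ℝ := Real.log (Real.log 2 / 2) / Real.log 2 with hc
  have hlim : Tendsto (fun n : ℕ => ((β + c / n : ℝ) : EReal)) atTop (𝓝 (β : EReal)) := by
    rw [EReal.tendsto_coe]
    simpa using (tendsto_const_div_atTop_nhds_zero_nat c).const_add β
  rw [← hlim.liminf_eq]
  refine liminf_le_liminf ?_
  filter_upwards [h, eventually_natCast_le_two_rpow hβ (show (0 : ℝ) < 1 / 2 by norm_num),
    eventually_gt_atTop 0] with n h1 h2 hn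
  have hn0 : (0 : ℝ) < n := by exact_mod_cast hn
  set P := (A n).blockErr z with hP
  have hY : 0 < (2 : ℝ) ^ (β * (n : ℝ)) := by positivity
  have h3 : P ≤ (2 : ℝ) ^ (-((2 : ℝ) ^ (β * (n : ℝ)) / 2)) := by
    refine h1.trans ?_
    rw [← Real.rpow_natCast, ← Real.rpow_add two_pos]
    exact Real.rpow_le_rpow_of_exponent_le one_le_two (by linarith)
  split_ifs with hP0 hP1
  · exact le_top
  · exfalso
    have : (2 : ℝ) ^ (-((2 : ℝ) ^ (β * (n : ℝ)) / 2)) < 1 :=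
      Real.rpow_lt_one_of_one_lt_of_neg one_lt_two (by linarith)
    linarith
  · rw [EReal.coe_le_coe_iff, Real.log_pow, le_div_iff₀ (by positivity)]
    have h4 := Real.log_le_log (not_le.1 hP0) h3
    rw [Real.log_rpow two_pos] at h4
    have h5 : Real.log 2 / 2 * (2 : ℝ) ^ (β * (n : ℝ)) ≤ -Real.log P := by linarith
    have h6 := Real.log_le_log (by positivity) h5
    rw [Real.log_mul (by positivity) hY.ne', Real.log_rpow two_pos] at h6
    refine le_trans (le_of_eq ?_) h6
    rw [hc]; field_simp; ring

/-- The scaling quotient of a gap of the form constant times 2^(-n/μ); the constant does not affect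
the limit. -/
lemma tendsto_mul_div_mul_add {μ ℓ : ℝ} (hμ : 0 < μ) (hℓ : 0 < ℓ) (c : ℝ) :
    Tendsto (fun n : ℕ => ((n * ℓ / (n * (ℓ / μ) + c) : ℝ) : EReal)) atTop (𝓝 (μ : EReal)) := by
  rw [EReal.tendsto_coe]
  have h : Tendsto (fun n : ℕ => ℓ / (ℓ / μ + c / n)) atTop (𝓝 (ℓ / (ℓ / μ + 0))) :=
    tendsto_const_nhds.div ((tendsto_const_div_atTop_nhds_zero_nat c).const_add _) (by positivity)
  have e : ℓ / (ℓ / μ + 0) = μ := by field_simp; ring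
  rw [e] at h
  refine h.congr' ?_
  filter_upwards [eventually_gt_atTop 0] with n hn
  have hn0 : (n : ℝ) ≠ 0 := by exact_mod_cast hn.ne'
  rw [← mul_div_mul_left ℓ _ hn0, mul_add, mul_div_cancel₀ c hn0]

lemma seriesScalingExponent_le {z μ C : ℝ} (hμ : 0 < μ) {A : PolarSeries}
    (h : ∀ᶠ n : ℕ in atTop, (A n).gap z ≤ C * (2 : ℝ) ^ (-(n : ℝ) / μ)) :
    seriesScalingExponent z A ≤ (μ : EReal) := by
  have hl : 0 < Real.log 2 := Real.log_pos one_lt_two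
  set D := max C 1 with hD
  have hD0 : 0 < D := lt_max_of_lt_right one_pos
  rw [← (tendsto_mul_div_mul_add hμ hl (-Real.log D)).limsup_eq]
  refine limsup_le_limsup ?_
  have hlarge : ∀ᶠ n : ℕ in atTop, 0 < n * (Real.log 2 / μ) + -Real.log D := by
    have : Tendsto (fun n : ℕ => n * (Real.log 2 / μ)) atTop atTop :=
      tendsto_natCast_atTop_atTop.atTop_mul_const (by positivity)
    filter_upwards [this.eventually_gt_atTop (Real.log D)] with n hn
    linarith
  filter_upwards [h, hlarge] with n h1 h2
  have h3 : (A n).gap z ≤ D * (2 : ℝ) ^ (-(n : ℝ) / μ) :=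
    h1.trans (mul_le_mul_of_nonneg_right (le_max_left _ _) (by positivity))
  have h4 : Real.log (D * (2 : ℝ) ^ (-(n : ℝ) / μ)) = -(n * (Real.log 2 / μ) + -Real.log D) := by
    rw [Real.log_mul hD0.ne' (by positivity), Real.log_rpow two_pos]; ring
  split_ifs with hg0 hg1
  · rw [← EReal.coe_zero, EReal.coe_le_coe_iff]; positivity
  · exfalso
    have := Real.log_le_log one_pos (hg1.trans h3)
    rw [Real.log_one, h4] at this
    linarith
  · rw [EReal.coe_le_coe_iff, Real.log_pow]
    have h5 := Real.log_le_log (not_le.1 hg0) h3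
    rw [h4] at h5
    rw [neg_div, ← div_neg]
    exact div_le_div_of_nonneg_left (by positivity) h2 (by linarith)

lemma le_seriesScalingExponent {z μ c : ℝ} (hμ : 0 < μ) (hc : 0 < c) {A : PolarSeries}
    (h : ∀ᶠ n : ℕ in atTop, c * (2 : ℝ) ^ (-(n : ℝ) / μ) ≤ (A n).gap z) :
    (μ : EReal) ≤ seriesScalingExponent z A := by
  have hl : 0 < Real.log 2 := Real.log_pos one_lt_two
  rw [← (tendsto_mul_div_mul_add hμ hl (-Real.log c)).limsup_eq]
  refine limsup_le_limsup ?_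
  filter_upwards [h] with n h1
  have h0 : 0 < c * (2 : ℝ) ^ (-(n : ℝ) / μ) := by positivity
  have h4 : Real.log (c * (2 : ℝ) ^ (-(n : ℝ) / μ)) = -(n * (Real.log 2 / μ) + -Real.log c) := by
    rw [Real.log_mul hc.ne' (by positivity), Real.log_rpow two_pos]; ring
  rw [if_neg (by linarith)]
  split_ifs with hg1
  · exact le_top
  · rw [EReal.coe_le_coe_iff, Real.log_pow]
    have h5 := Real.log_le_log h0 h1
    rw [h4] at h5
    have h6 := Real.log_neg (h0.trans_le h1) (not_le.1 hg1)
    rw [neg_div, ← div_neg]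
    exact div_le_div_of_nonneg_left (by positivity) (by linarith) (by linarith)

/-! ### Achievability -/

/-- With ξ = γ/(1 - π(1-γ)) the left side of (1) is that of (2) with μ* in place of μ, and μ* ≥ μ
only lowers it. -/
lemma mainCondition_of_numericCondition {μ μs γ : ℝ} (hμ : 0 < μ) (hnum : NumericCondition μ)
    (hle : μ ≤ μs) (hγ : γ ∈ Ioo (0 : ℝ) 1) :
    MainCondition μs (0.4469 * γ) (μs / (1 - γ)) := by
  obtain ⟨hγ0, hγ1⟩ := hγ
  intro π hπ
  have hμs : 0 < μs := by linarith
  have h1 : 0 < 1 - γ := by linarith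
  have hd : 0 < 1 - π * (1 - γ) := by nlinarith [hπ.1, hπ.2]
  have hξ : γ / (1 - π * (1 - γ)) ∈ Icc (0 : ℝ) 1 :=
    ⟨by positivity, by rw [div_le_one hd]; nlinarith [hπ.1, hπ.2]⟩
  have key := hnum _ hξ
  have e0 : μs / (1 - γ) - μs * π = μs * (1 - π * (1 - γ)) / (1 - γ) := by
    field_simp
  have e1 : 0.4469 * γ * (μs / (1 - γ)) / (μs / (1 - γ) - μs * π) =
      0.4469 * (γ / (1 - π * (1 - γ))) := by
    rw [e0]; field_simp
  have e2 : (1 - π) / (μs / (1 - γ) - μs * π) = (1 - γ / (1 - π * (1 - γ))) / μs := by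
    rw [e0]; field_simp; ring
  rw [e1, e2]
  have h2 : (1 - γ / (1 - π * (1 - γ))) / μs ≤ (1 - γ / (1 - π * (1 - γ))) / μ :=
    div_le_div_of_nonneg_left (by linarith [hξ.2]) hμ hle
  linarith

open Classical in
/-- The code made of the synthetic channels of erasure probability at most `ε`. -/
noncomputable def thresholdCode (z ε : ℝ) (n : ℕ) : PolarCode n :=
  Finset.univ.filter fun j => synthZ z n j ≤ ε

lemma sumErr_thresholdCode_le {ε : ℝ} (hε : 0 ≤ ε) (z : ℝ) (n : ℕ) :
    (thresholdCode z ε n).sumErr z ≤ 2 ^ n * ε := by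
  have h : (thresholdCode z ε n).sumErr z ≤ (thresholdCode z ε n).card • ε :=
    Finset.sum_le_card_nsmul _ _ _ fun j hj => (Finset.mem_filter.1 hj).2
  refine h.trans ?_
  rw [nsmul_eq_mul]
  refine mul_le_mul_of_nonneg_right ?_ hε
  have := Finset.card_le_univ (thresholdCode z ε n)
  rw [Fintype.card_fin] at this
  exact_mod_cast this

lemma two_pow_mul_gap_thresholdCode (z ε : ℝ) (n : ℕ) :
    2 ^ n * (thresholdCode z ε n).gap z =
      2 ^ n * polarStep^[n] (fun y => if ε < y then 1 - y else 0) z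
        - (thresholdCode z ε n).sumErr z := by
  classical
  rw [PolarCode.gap_eq, ← sum_synthZ, ← Finset.sum_filter]
  congr 2
  ext j
  simp [thresholdCode]

lemma achievable_of_eigenCriterion {h : ℝ → ℝ} {μ μs γ : ℝ} (hμ : 0 < μ)
    (hnum : NumericCondition μ) (hle : μ ≤ μs) (hh : EigenCriterion h μs)
    (hγ : γ ∈ Ioo (0 : ℝ) 1) : Achievable (0.4469 * γ) (μs / (1 - γ)) := by
  intro z hz
  obtain ⟨C, hC⟩ := exists_tail_bound hμ hnum hle hh hγ
  have hγ0 := hγ.1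
  have h1 : 0 < 1 - γ := by linarith [hγ.2]
  have hμs : 0 < μs := by linarith
  have hβ : 0 < 0.4469 * γ := by positivity
  have hμ' : 0 < μs / (1 - γ) := by positivity
  have hw : ∀ n : ℕ, (((2 : ℝ) ^ (-1 / μs)) ^ (1 - γ)) ^ n =
      (2 : ℝ) ^ (-(n : ℝ) / (μs / (1 - γ))) := by
    intro n
    rw [← Real.rpow_mul two_pos.le, ← Real.rpow_mul_natCast two_pos.le]
    congr 1; field_simp
  set ε : ℕ → ℝ := fun n => (2 : ℝ) ^ (-(2 : ℝ) ^ (0.4469 * γ * (n : ℝ))) with hε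
  set A : PolarSeries := fun n => thresholdCode z (ε n) n with hA
  have hε0 : ∀ n, 0 < ε n := fun n => by positivity
  have hsum : ∀ n, (A n).sumErr z ≤ 2 ^ n * ε n :=
    fun n => sumErr_thresholdCode_le (hε0 n).le z n
  have hsum0 : ∀ n, 0 ≤ (A n).sumErr z :=
    fun n => Finset.sum_nonneg fun j _ => (synthZ_mem hz n j).1
  have hgap : ∀ n, (A n).gap z ≤ C * (2 : ℝ) ^ (-(n : ℝ) / (μs / (1 - γ))) := by
    intro n
    have e : 2 ^ n * (A n).gap z = 2 ^ n * polarStep^[n] (fun y => if ε n < y then 1 - y else 0) z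
        - (A n).sumErr z := two_pow_mul_gap_thresholdCode z (ε n) n
    have hb : polarStep^[n] (fun y => if ε n < y then 1 - y else 0) z ≤ _ := hC n z hz
    rw [hw] at hb
    have hp : (0 : ℝ) < 2 ^ n := by positivity
    refine le_trans ?_ hb
    refine le_of_mul_le_mul_left ?_ hp
    linarith [hsum0 n]
  -- The gap may be negative, but by no more than ε_n, so its absolute value is controlled too.
  have hgap2 : ∀ n, -ε n ≤ (A n).gap z := by
    intro n
    have e : 2 ^ n * (A n).gap z = 2 ^ n * polarStep^[n] (fun y => if ε n < y then 1 - y else 0) z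
        - (A n).sumErr z := two_pow_mul_gap_thresholdCode z (ε n) n
    have hp : (0 : ℝ) < 2 ^ n := by positivity
    have h0 : 0 ≤ polarStep^[n] (fun y => if ε n < y then 1 - y else 0) z := by
      refine polarStep_iterate_nonneg (fun x hx => ?_) n z hz
      split_ifs
      · linarith [hx.2]
      · exact le_rfl
    refine le_of_mul_le_mul_left ?_ hp
    have := mul_nonneg hp.le h0
    linarith [hsum n]
  have hblock : ∀ n, (A n).blockErr z ≤ 2 ^ n * ε n :=
    fun n => (PolarCode.blockErr_le_sumErr hz _).trans (hsum n)
  refine ⟨A, ⟨Eventually.of_forall hsum, Eventually.of_forall hblock, ?_,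
    le_errorExponent_of_eventually_le hβ (Eventually.of_forall hblock),
    seriesScalingExponent_le hμ' (Eventually.of_forall hgap)⟩⟩
  refine Asymptotics.IsBigO.of_bound (max C 1) ?_
  filter_upwards [eventually_natCast_le_two_rpow hβ hμ'] with n hn
  have hv : 0 < (2 : ℝ) ^ (-(n : ℝ) / (μs / (1 - γ))) := by positivity
  rw [Real.norm_eq_abs, Real.norm_eq_abs, abs_of_pos hv, abs_le]
  constructor
  · have h3 : ε n ≤ (2 : ℝ) ^ (-(n : ℝ) / (μs / (1 - γ))) := by
      apply Real.rpow_le_rpow_of_exponent_le one_le_two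
      rw [neg_div, neg_le_neg_iff, div_le_iff₀' hμ']
      exact hn
    have h4 : (2 : ℝ) ^ (-(n : ℝ) / (μs / (1 - γ))) ≤
        max C 1 * (2 : ℝ) ^ (-(n : ℝ) / (μs / (1 - γ))) :=
      le_mul_of_one_le_left hv.le (le_max_right _ _)
    linarith [hgap2 n]
  · exact (hgap n).trans (mul_le_mul_of_nonneg_right (le_max_left _ _) hv.le)

/-! ### Consequences of the Scaling Assumption -/

/-- With w = x(1-x), the two radicands A and B of the multiplier satisfy A + B = 2 - 2w and AB =
w(2+w) ≥ w², so (√A + √B)² ≥ 2. -/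
lemma polarStep_unitBump_half_ge {x : ℝ} (hx : x ∈ Icc (0 : ℝ) 1) :
    (2 : ℝ) ^ (-(1 / 2) : ℝ) * unitBump (1 / 2) x ≤ polarStep (unitBump (1 / 2)) x := by
  rw [polarStep_unitBump _ hx]
  refine mul_le_mul_of_nonneg_right ?_ (unitBump_nonneg _ hx)
  rw [Real.rpow_neg two_pos.le, ← Real.sqrt_eq_rpow, ← Real.sqrt_eq_rpow, ← Real.sqrt_eq_rpow]
  have hw := mul_one_sub_mem_unit hx
  have hp : 0 ≤ x * (1 + x) := mul_nonneg hx.1 (by linarith [hx.1])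
  have hq : 0 ≤ (2 - x) * (1 - x) := mul_nonneg (by linarith [hx.2]) (by linarith [hx.2])
  have hpq : x * (1 - x) ≤ √(x * (1 + x)) * √((2 - x) * (1 - x)) := by
    rw [← Real.sqrt_mul hp]
    refine Real.le_sqrt_of_sq_le ?_
    nlinarith [hw.1]
  have h2 : √2 ≤ √(x * (1 + x)) + √((2 - x) * (1 - x)) := by
    rw [Real.sqrt_le_left (by positivity), add_sq, Real.sq_sqrt hp, Real.sq_sqrt hq]
    nlinarith
  have h3 : (√2)⁻¹ = √2 / 2 := by
    rw [inv_eq_one_div, div_eq_div_iff (by positivity) two_ne_zero, one_mul,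
      Real.mul_self_sqrt two_pos.le]
  rw [h3]
  linarith

lemma pow_mul_unitBump_half_le (n : ℕ) {x : ℝ} (hx : x ∈ Icc (0 : ℝ) 1) :
    ((2 : ℝ) ^ (-(1 / 2) : ℝ)) ^ n * unitBump (1 / 2) x ≤ polarStep^[n] (unitBump (1 / 4)) x := by
  refine (polarStep_iterate_pow_le (by positivity)
    (fun y hy => polarStep_unitBump_half_ge hy) n x hx).trans ?_
  refine polarStep_iterate_mono (fun y hy => ?_) n x hx
  have hw := mul_one_sub_mem_unit hy
  exact Real.rpow_le_rpow_of_exponent_ge_of_imp hw.1 hw.2 (by norm_num) (fun _ h => by norm_num at h)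

/-- Outside (a, 1-a) the bump contracts by κ and inside its image is at most 1, so e_(n+1) ≤ κ e_n +
P(a < Z_n < 1-a). The source term is O(t^n) with t > κ. The constant still depends on z. -/
lemma polarStep_iterate_unitBump_le {κ t μ z : ℝ} (hκ : (2 : ℝ) ^ ((1 / 4 : ℝ) - 1) < κ)
    (hκt : κ < t) (ht : (2 : ℝ) ^ (-1 / μ) ≤ t) (h : ScalingAssumption μ) (hz : z ∈ Ioo (0 : ℝ) 1) :
    ∃ C : ℝ, ∀ n : ℕ, polarStep^[n] (unitBump (1 / 4)) z ≤ C * t ^ n := by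
  classical
  obtain ⟨a, ha0, ha1, hend⟩ := exists_polarStep_unitBump_le (by norm_num) hκ
  obtain ⟨L, -, hL⟩ := h.2 z hz a ⟨ha0, by linarith⟩ (1 - a) ⟨by linarith, by linarith⟩ (by linarith)
  obtain ⟨B, hB⟩ := hL.bddAbove_range
  have hκ0 : 0 < κ := lt_trans (by positivity) hκ
  have ht0 : 0 < t := by linarith
  have hz' : z ∈ Icc (0 : ℝ) 1 := Ioo_subset_Icc_self hz
  have hB0 : 0 ≤ B := by
    refine le_trans ?_ (hB ⟨0, rfl⟩)
    simp only [probBetween]; positivity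
  have hp : ∀ n : ℕ, probBetween z a (1 - a) n ≤ B * t ^ n := by
    intro n
    have h1 : (2 : ℝ) ^ ((n : ℝ) / μ) * probBetween z a (1 - a) n ≤ B := hB ⟨n, rfl⟩
    rw [mul_comm, ← le_div_iff₀ (by positivity), div_eq_mul_inv, ← Real.rpow_neg two_pos.le] at h1
    refine h1.trans (mul_le_mul_of_nonneg_left ?_ hB0)
    rw [show -((n : ℝ) / μ) = -1 / μ * n by ring, Real.rpow_mul_natCast two_pos.le]
    exact pow_le_pow_left₀ (by positivity) ht n
  have hstep : ∀ x ∈ Icc (0 : ℝ) 1, polarStep (unitBump (1 / 4)) x ≤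
      κ * unitBump (1 / 4) x + 1 * (if a < x ∧ x < 1 - a then 1 else 0) := by
    intro x hx
    by_cases hc : a < x ∧ x < 1 - a
    · rw [if_pos hc]
      have h1 := polarStep_le_one (fun y hy => unitBump_le_one (by norm_num) hy) hx
        (φ := unitBump (1 / 4))
      have h2 := mul_nonneg hκ0.le (unitBump_nonneg (1 / 4) hx)
      linarith
    · rw [if_neg hc]
      rw [not_and_or, not_lt, not_lt] at hc
      linarith [hend x hx hc]
  refine ⟨max 1 (B / (t - κ)), fun n => ?_⟩
  induction n with
  | zero =>
    simp only [Function.iterate_zero, id_eq, pow_zero, mul_one]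
    exact (unitBump_le_one (by norm_num) hz').trans (le_max_left _ _)
  | succ n ih =>
    have h1 := polarStep_iterate_mono hstep n z hz'
    rw [polarStep_iterate_linear (unitBump (1 / 4)), ← probBetween_eq,
      ← Function.iterate_succ_apply] at h1
    have h2 : B ≤ max 1 (B / (t - κ)) * (t - κ) := by
      rw [← div_le_iff₀ (by linarith)]; exact le_max_right _ _
    have h3 := mul_le_mul_of_nonneg_right h2 (pow_nonneg ht0.le n)
    have h4 := mul_le_mul_of_nonneg_left ih hκ0.le
    rw [pow_succ t]
    linarith [hp n]

lemma two_rpow_neg_three_quarters_lt : (2 : ℝ) ^ ((1 / 4 : ℝ) - 1) < (2 : ℝ) ^ (-(1 / 2) : ℝ) :=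
  Real.rpow_lt_rpow_of_exponent_lt one_lt_two (by norm_num)

/-- If μ < 2, the expected bump would decay faster than 2^(-n/2), against
`pow_mul_unitBump_half_le`. The exponent 1/4 serves because its end rate 2^(-3/4) is below 2^(-1/2).
-/
lemma ScalingAssumption.two_le {μ : ℝ} (h : ScalingAssumption μ) : 2 ≤ μ := by
  by_contra! hμ
  have hs : (2 : ℝ) ^ (-1 / μ) < (2 : ℝ) ^ (-(1 / 2) : ℝ) := by
    apply Real.rpow_lt_rpow_of_exponent_lt one_lt_two
    rw [neg_div, neg_lt_neg_iff]
    exact one_div_lt_one_div_of_lt h.1 hμ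
  obtain ⟨κ, hκ1, hκ2⟩ := exists_between two_rpow_neg_three_quarters_lt
  obtain ⟨t, ht1, ht2⟩ := exists_between (max_lt hκ2 hs)
  rw [max_lt_iff] at ht1
  have hz : (1 / 2 : ℝ) ∈ Ioo (0 : ℝ) 1 := by norm_num
  obtain ⟨C, hC⟩ := polarStep_iterate_unitBump_le hκ1 ht1.1 ht1.2.le h hz
  have hb := unitBump_pos (1 / 2) hz
  have ht0 : 0 < t := lt_trans (by positivity) ht1.2
  have hlim := (tendsto_pow_atTop_atTop_of_one_lt ((one_lt_div ht0).2 ht2)).eventually_gt_atTop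
    (C / unitBump (1 / 2) (1 / 2))
  obtain ⟨n, hn⟩ := hlim.exists
  have h1 := (pow_mul_unitBump_half_le n (Ioo_subset_Icc_self hz)).trans (hC n)
  rw [div_lt_iff₀ hb, div_pow, div_mul_eq_mul_div, lt_div_iff₀ (by positivity)] at hn
  linarith

lemma ScalingAssumption.half_le {μ : ℝ} (h : ScalingAssumption μ) :
    (2 : ℝ) ^ (-(1 / 2) : ℝ) ≤ (2 : ℝ) ^ (-1 / μ) := by
  apply Real.rpow_le_rpow_of_exponent_le one_le_two
  rw [neg_div, neg_le_neg_iff]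
  exact one_div_le_one_div_of_le two_pos h.two_le

lemma continuous_polarStep_iterate {φ : ℝ → ℝ} (hφ : Continuous φ) (n : ℕ) :
    Continuous (polarStep^[n] φ) := by
  induction n with
  | zero => exact hφ
  | succ n ih =>
    have : polarStep^[n + 1] φ =
      fun x => (polarStep^[n] φ (x ^ 2) + polarStep^[n] φ (2 * x - x ^ 2)) / 2 :=
      funext (polarStep_iterate_succ φ n)
    rw [this]
    fun_prop

/-- Baire: a pointwise bound by a constant depending on the starting point is uniform on some
interval of starting points. -/
lemma exists_uniform_interval {u : ℕ → ℝ → ℝ} {s : ℝ} (hu : ∀ n, Continuous (u n))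
    (hs : 0 ≤ s) (h : ∀ z ∈ Ioo (0 : ℝ) 1, ∃ C, ∀ n, u n z ≤ C * s ^ n) :
    ∃ c d C : ℝ, 0 < c ∧ c < d ∧ d < 1 ∧ ∀ z ∈ Icc c d, ∀ n, u n z ≤ C * s ^ n := by
  have hsub : Icc (1 / 4 : ℝ) (3 / 4) ⊆ Ioo 0 1 :=
    fun x hx => ⟨by linarith [hx.1], by linarith [hx.2]⟩
  let F : ℕ → Set (Icc (1 / 4 : ℝ) (3 / 4)) := fun k => {z | ∀ n, u n z ≤ k * s ^ n}
  have hF : ∀ k, IsClosed (F k) := by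
    intro k
    simp only [F, Set.ofPred_forall]
    refine isClosed_iInter fun n => isClosed_le ((hu n).comp continuous_subtype_val) (by fun_prop)
  have hcov : ⋃ k, F k = univ := by
    refine eq_univ_of_forall fun z => mem_iUnion.2 ?_
    obtain ⟨C, hC⟩ := h z (hsub z.2)
    obtain ⟨k, hk⟩ := exists_nat_ge C
    exact ⟨k, fun n => (hC n).trans (mul_le_mul_of_nonneg_right hk (by positivity))⟩
  have : Nonempty (Icc (1 / 4 : ℝ) (3 / 4)) := ⟨⟨1 / 2, by norm_num⟩⟩
  obtain ⟨k, z, hz⟩ := nonempty_interior_of_iUnion_of_closed hF hcov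
  obtain ⟨ε, hε, hball⟩ := Metric.mem_nhds_iff.1 (mem_interior_iff_mem_nhds.1 hz)
  have hz1 := z.2.1
  have hz2 := z.2.2
  set δ := min (ε / 2) (1 / 4) with hδ
  have hδ0 : 0 < δ := by positivity
  have hδ1 : δ ≤ ε / 2 := min_le_left _ _
  have hδ2 : δ ≤ 1 / 4 := min_le_right _ _
  have key : ∀ y : ℝ, y ∈ Icc (1 / 4 : ℝ) (3 / 4) → |y - z| ≤ δ → ∀ n, u n y ≤ k * s ^ n := by
    intro y hy hyz
    have : (⟨y, hy⟩ : Icc (1 / 4 : ℝ) (3 / 4)) ∈ F k := by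
      apply hball
      rw [Metric.mem_ball, Subtype.dist_eq, Real.dist_eq]
      simp only
      linarith
    exact this
  -- The point z may be an endpoint of the window, so the interval is taken on the side that has
  -- room.
  rcases le_total (z : ℝ) (1 / 2) with hc | hc
  · refine ⟨z, z + δ, k, by linarith, by linarith, by linarith, fun y hy => ?_⟩
    exact key y ⟨by linarith [hy.1], by linarith [hy.2]⟩
      (by rw [abs_of_nonneg (by linarith [hy.1])]; linarith [hy.2])
  · refine ⟨z - δ, z, k, by linarith, by linarith, by linarith, fun y hy => ?_⟩
    exact key y ⟨by linarith [hy.1], by linarith [hy.2]⟩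
      (by rw [abs_of_nonpos (by linarith [hy.2])]; linarith [hy.1])

/-- The composed maps are close to step functions, whose jumps are spread uniformly: some of them
jump inside a given interval. -/
lemma exists_synthZ_jump {a c d : ℝ} (ha : 0 < a) (hc : c ∈ Icc (0 : ℝ) 1)
    (hd : d ∈ Icc (0 : ℝ) 1) (hcd : c < d)
    (h1 : Tendsto (fun n => polarStep^[n] (unitBump (1 / 4)) c) atTop (𝓝 0))
    (h2 : Tendsto (fun n => polarStep^[n] (unitBump (1 / 4)) d) atTop (𝓝 0)) :
    ∃ k, ∃ j : Fin (2 ^ k), synthZ c k j ≤ a ∧ 1 - a ≤ synthZ d k j := by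
  by_contra! hcon
  have hle : ∀ y ∈ Icc (0 : ℝ) 1, y * (1 - y) ≤ unitBump (1 / 4) y := by
    intro y hy
    have hw := mul_one_sub_mem_unit hy
    have := Real.rpow_le_rpow_of_exponent_ge_of_imp hw.1 hw.2 (show (1 / 4 : ℝ) ≤ 1 by norm_num)
      (fun _ h => by norm_num at h)
    rwa [Real.rpow_one] at this
  -- The increments from c to d average to d - c. Without a jump, a times each increment is at most
  -- the bump at one of its two ends, and the bumps vanish on average.
  have key : ∀ n, a * (d - c) ≤
      polarStep^[n] (unitBump (1 / 4)) c + polarStep^[n] (unitBump (1 / 4)) d := by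
    intro n
    have hp : (0 : ℝ) < 2 ^ n := by positivity
    refine le_of_mul_le_mul_left ?_ hp
    have e1 := sum_synthZ (fun y => y) c n
    have e2 := sum_synthZ (fun y => y) d n
    rw [polarStep_iterate_id] at e1 e2
    calc 2 ^ n * (a * (d - c))
        = ∑ j : Fin (2 ^ n), a * (synthZ d n j - synthZ c n j) := by
          rw [← Finset.mul_sum, Finset.sum_sub_distrib, e1, e2]; ring
      _ ≤ ∑ j : Fin (2 ^ n),
          (unitBump (1 / 4) (synthZ c n j) + unitBump (1 / 4) (synthZ d n j)) := by
          refine Finset.sum_le_sum fun j _ => ?_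
          have hx := synthZ_mem hc n j
          have hy := synthZ_mem hd n j
          have gx := hle _ hx
          have gy := hle _ hy
          have nx := (mul_one_sub_mem_unit hx).1
          have ny := (mul_one_sub_mem_unit hy).1
          have hj := hcon n j
          set x := synthZ c n j
          set y := synthZ d n j
          rcases le_or_gt x a with hxa | hxa
          · have h3 := hj hxa
            nlinarith [hx.1, hy.1, mul_nonneg ha.le hx.1]
          · nlinarith [hx.2, hy.2, mul_nonneg ha.le (sub_nonneg.2 hy.2)]
      _ = _ := by
          rw [Finset.sum_add_distrib, sum_synthZ, sum_synthZ]; ring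
  have hlim := ge_of_tendsto' (h1.add h2) key
  have : 0 < a * (d - c) := mul_pos ha (by linarith)
  linarith

/-- Baire gives uniformity on some [c, d]. A synthetic channel jumping there maps a subset of [c, d]
onto [a, 1-a] by the intermediate value theorem, which carries the bound to the middle. Near the
ends the contraction κ < 2^(-1/μ) propagates it, keeping the factor `unitBump (1 / 4) x`. -/
lemma ScalingAssumption.exists_uniform_bound {μ : ℝ} (h : ScalingAssumption μ) :
    ∃ C : ℝ, 0 < C ∧ ∀ n : ℕ, ∀ x ∈ Icc (0 : ℝ) 1,
      polarStep^[n] (unitBump (1 / 4)) x ≤ C * ((2 : ℝ) ^ (-1 / μ)) ^ n * unitBump (1 / 4) x := by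
  set s := (2 : ℝ) ^ (-1 / μ) with hs
  have hs0 : 0 < s := by positivity
  have hs1 : s < 1 :=
    Real.rpow_lt_one_of_one_lt_of_neg one_lt_two (div_neg_of_neg_of_pos (by norm_num) h.1)
  obtain ⟨κ, hκ1, hκ2⟩ := exists_between two_rpow_neg_three_quarters_lt
  have hκs : κ < s := hκ2.trans_le h.half_le
  have hpt : ∀ z ∈ Ioo (0 : ℝ) 1, ∃ C, ∀ n : ℕ, polarStep^[n] (unitBump (1 / 4)) z ≤ C * s ^ n :=
    fun z hz => polarStep_iterate_unitBump_le hκ1 hκs le_rfl h hz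
  obtain ⟨c, d, K, hc, hcd, hd, hK⟩ := exists_uniform_interval
    (u := fun n => polarStep^[n] (unitBump (1 / 4)))
    (fun n => continuous_polarStep_iterate (continuous_unitBump (by norm_num)) n) hs0.le hpt
  have hlim : ∀ z ∈ Ioo (0 : ℝ) 1,
      Tendsto (fun n => polarStep^[n] (unitBump (1 / 4)) z) atTop (𝓝 0) := by
    intro z hz
    obtain ⟨C, hC⟩ := hpt z hz
    refine squeeze_zero (fun n => polarStep_iterate_nonneg
      (fun x hx => unitBump_nonneg _ hx) n z (Ioo_subset_Icc_self hz)) hC ?_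
    simpa using (tendsto_pow_atTop_nhds_zero_of_lt_one hs0.le hs1).const_mul C
  obtain ⟨a, ha0, ha1, hend⟩ := exists_polarStep_unitBump_le (by norm_num) hκ1
  have hcI : c ∈ Ioo (0 : ℝ) 1 := ⟨hc, by linarith⟩
  have hdI : d ∈ Ioo (0 : ℝ) 1 := ⟨by linarith, hd⟩
  obtain ⟨k, j, hj1, hj2⟩ := exists_synthZ_jump ha0 (Ioo_subset_Icc_self hcI)
    (Ioo_subset_Icc_self hdI) hcd (hlim c hcI) (hlim d hdI)
  have hmid : ∀ x ∈ Icc a (1 - a), ∀ n : ℕ,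
      polarStep^[n] (unitBump (1 / 4)) x ≤ 2 ^ k * |K| * s ^ n := by
    intro x hx n
    obtain ⟨y, hy, rfl⟩ := intermediate_value_Icc hcd.le
      (continuous_synthZ k j).continuousOn ⟨hj1.trans hx.1, hx.2.trans hj2⟩
    have hy' : y ∈ Icc (0 : ℝ) 1 := ⟨by linarith [hy.1], by linarith [hy.2]⟩
    have h1 := le_two_pow_mul_polarStep_iterate (φ := polarStep^[n] (unitBump (1 / 4)))
      (fun x hx => polarStep_iterate_nonneg (fun x hx => unitBump_nonneg _ hx) n x hx) hy' k j
    rw [← Function.iterate_add_apply] at h1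
    refine h1.trans ?_
    rw [mul_assoc]
    refine mul_le_mul_of_nonneg_left ?_ (by positivity)
    refine (hK y hy (k + n)).trans ?_
    rw [pow_add]
    calc K * (s ^ k * s ^ n) ≤ |K| * (1 * s ^ n) := by
          gcongr
          · exact le_abs_self K
          · exact pow_le_one₀ hs0.le hs1.le
      _ = _ := by ring
  set b : ℝ := (a * a) ^ (1 / 4 : ℝ) with hb
  have hb0 : 0 < b := by positivity
  have hbx : ∀ x ∈ Icc a (1 - a), b ≤ unitBump (1 / 4) x := by
    intro x hx
    refine Real.rpow_le_rpow (by positivity) ?_ (by norm_num)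
    exact mul_le_mul hx.1 (by linarith [hx.2]) ha0.le (by linarith [hx.1])
  set C : ℝ := 1 + 2 ^ k * |K| / b with hC
  have hC0 : 0 < C := by positivity
  refine ⟨C, hC0, fun n => ?_⟩
  induction n with
  | zero =>
    intro x hx
    simp only [Function.iterate_zero, id_eq, pow_zero, mul_one]
    refine le_mul_of_one_le_left (unitBump_nonneg _ hx) ?_
    have : 0 ≤ 2 ^ k * |K| / b := by positivity
    linarith
  | succ n ih =>
    intro x hx
    by_cases hxa : x ≤ a ∨ 1 - a ≤ x
    · rw [polarStep_iterate_succ]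
      have h1 := ih _ (sq_mem_unit hx)
      have h2 := ih _ (two_mul_sub_sq_mem_unit hx)
      have h3 := hend x hx hxa
      rw [polarStep] at h3
      have h4 : κ * unitBump (1 / 4) x ≤ s * unitBump (1 / 4) x :=
        mul_le_mul_of_nonneg_right hκs.le (unitBump_nonneg _ hx)
      have h5 := mul_le_mul_of_nonneg_left (h3.trans h4) (by positivity : 0 ≤ C * s ^ n)
      rw [pow_succ s]
      linarith
    · push Not at hxa
      have hx' : x ∈ Icc a (1 - a) := ⟨hxa.1.le, hxa.2.le⟩
      have h1 : 2 ^ k * |K| ≤ C * unitBump (1 / 4) x := by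
        have h2 : 2 ^ k * |K| ≤ C * b := by
          rw [hC, add_mul, div_mul_cancel₀ _ hb0.ne']; linarith
        exact h2.trans (mul_le_mul_of_nonneg_left (hbx x hx') hC0.le)
      calc _ ≤ 2 ^ k * |K| * s ^ (n + 1) := hmid x hx' (n + 1)
        _ ≤ C * unitBump (1 / 4) x * s ^ (n + 1) := by gcongr
        _ = _ := by ring

/-- The function is f = Σ_{k<N} l^(-k) T^k g with 2^(-1/μ) < l < 2^(-1/μ*). Telescoping gives Tf =
l(f - g + l^(-N) T^N g), and for N large the uniform bound makes the last term at most g. Division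
by M brings the values into [0, 1]. -/
lemma ScalingAssumption.exists_eigenCriterion {μ μs : ℝ} (h : ScalingAssumption μ)
    (hμ : μ < μs) : ∃ f : ℝ → ℝ, EigenCriterion f μs := by
  obtain ⟨C, hC0, hC⟩ := h.exists_uniform_bound
  set s := (2 : ℝ) ^ (-1 / μ) with hs
  have hs0 : 0 < s := by positivity
  have hlt : s < (2 : ℝ) ^ (-1 / μs) := by
    apply Real.rpow_lt_rpow_of_exponent_lt one_lt_two
    rw [neg_div, neg_div, neg_lt_neg_iff]
    exact one_div_lt_one_div_of_lt h.1 hμ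
  obtain ⟨l, hl1, hl2⟩ := exists_between hlt
  have hl0 : 0 < l := by linarith
  obtain ⟨N, hN⟩ := ((tendsto_pow_atTop_nhds_zero_of_lt_one (by positivity)
    ((div_lt_one hl0).2 hl1)).const_mul C).eventually_lt_const
      (show C * 0 < 1 by norm_num) |>.and (eventually_gt_atTop 0) |>.exists
  set g := unitBump (1 / 4) with hg
  set u : ℕ → ℝ → ℝ := fun n => polarStep^[n] g with hu
  have hu0 : ∀ n, ∀ x ∈ Icc (0 : ℝ) 1, 0 ≤ u n x := fun n =>
    polarStep_iterate_nonneg (fun x hx => unitBump_nonneg _ hx) n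
  have hu1 : ∀ n, ∀ x ∈ Icc (0 : ℝ) 1, u n x ≤ 1 := by
    intro n x hx
    have := polarStep_iterate_mono (fun x hx => unitBump_le_one (α := 1 / 4) (by norm_num) hx) n x hx
    rwa [polarStep_iterate_const] at this
  set f : ℝ → ℝ := fun x => ∑ k ∈ Finset.range N, l⁻¹ ^ k * u k x with hf
  set M : ℝ := ∑ k ∈ Finset.range N, l⁻¹ ^ k with hM
  have hgf : ∀ x ∈ Icc (0 : ℝ) 1, g x ≤ f x := by
    intro x hx
    have := Finset.single_le_sum (f := fun k => l⁻¹ ^ k * u k x)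
      (fun k _ => mul_nonneg (by positivity) (hu0 k x hx)) (Finset.mem_range.2 hN.2)
    simpa [hu, hf] using this
  have hfM : ∀ x ∈ Icc (0 : ℝ) 1, f x ≤ M := fun x hx =>
    Finset.sum_le_sum fun k _ => mul_le_of_le_one_right (by positivity) (hu1 k x hx)
  have hM0 : 0 < M := Finset.sum_pos (fun k _ => by positivity) (Finset.nonempty_range_iff.2 hN.2.ne')
  have hstep : ∀ x ∈ Icc (0 : ℝ) 1, polarStep f x ≤ l * f x := by
    intro x hx
    have e1 : polarStep f x = ∑ k ∈ Finset.range N, l⁻¹ ^ k * u (k + 1) x := by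
      simp only [polarStep, hf]
      rw [← Finset.sum_add_distrib, Finset.sum_div]
      refine Finset.sum_congr rfl fun k _ => ?_
      simp only [hu, polarStep_iterate_succ]; ring
    have e2 : polarStep f x = l * (f x - g x + l⁻¹ ^ N * u N x) := by
      have h1 := Finset.sum_range_succ (fun k => l⁻¹ ^ k * u k x) N
      rw [Finset.sum_range_succ'] at h1
      have h2 : ∑ k ∈ Finset.range N, l⁻¹ ^ (k + 1) * u (k + 1) x = l⁻¹ * polarStep f x := by
        rw [e1, Finset.mul_sum]
        exact Finset.sum_congr rfl fun k _ => by ring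
      rw [h2] at h1
      simp only [hu, pow_zero, one_mul, Function.iterate_zero, id_eq] at h1
      have h3 : l⁻¹ * polarStep f x = f x - g x + l⁻¹ ^ N * u N x := by
        simp only [hf, hu]; linarith
      rw [← h3, mul_inv_cancel_left₀ hl0.ne']
    have h4 : l⁻¹ ^ N * u N x ≤ g x := by
      calc l⁻¹ ^ N * u N x ≤ l⁻¹ ^ N * (C * s ^ N * g x) := by gcongr; exact hC N x hx
        _ = (C * (s / l) ^ N) * g x := by rw [div_eq_mul_inv, mul_pow]; ring
        _ ≤ 1 * g x := mul_le_mul_of_nonneg_right hN.1.le (unitBump_nonneg _ hx)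
        _ = g x := one_mul _
    rw [e2]
    exact mul_le_mul_of_nonneg_left (by linarith) hl0.le
  have hend : ∀ x ∈ Icc (0 : ℝ) 1, g x = 0 → f x = 0 := by
    intro x hx h0
    refine Finset.sum_eq_zero fun k _ => ?_
    have h1 := hC k x hx
    rw [h0, mul_zero] at h1
    rw [show u k x = 0 from le_antisymm h1 (hu0 k x hx), mul_zero]
  refine ⟨fun x => f x / M, ⟨by linarith [h.two_le], ?_, ?_, ?_, ?_, l, hl2, ?_⟩⟩
  · intro x hx
    exact ⟨div_nonneg ((unitBump_nonneg _ hx).trans (hgf x hx)) hM0.le,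
      (div_le_one hM0).2 (hfM x hx)⟩
  · simp [hend 0 (by simp) (unitBump_zero (by norm_num))]
  · simp [hend 1 (by simp) (unitBump_one (by norm_num))]
  · intro a b ha hb
    have hb' : 0 < 1 - b := by linarith
    refine ⟨(a * (1 - b)) ^ (1 / 4 : ℝ) / M, by positivity, fun x hx => ?_⟩
    have hx' : x ∈ Icc (0 : ℝ) 1 := ⟨by linarith [hx.1], by linarith [hx.2]⟩
    refine div_le_div_of_nonneg_right (le_trans ?_ (hgf x hx')) hM0.le
    refine Real.rpow_le_rpow (by positivity) ?_ (by norm_num)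
    exact mul_le_mul hx.1 (by linarith [hx.2]) hb'.le hx'.1
  · intro x hx
    have hx' := Ioo_subset_Icc_self hx
    have hpos : 0 < f x := (unitBump_pos _ hx).trans_le (hgf x hx')
    have h1 := hstep x hx'
    rw [polarStep] at h1
    rw [div_le_iff₀ (by positivity), ← add_div, ← mul_div_assoc, ← mul_div_assoc]
    exact div_le_div_of_nonneg_right (by linarith) hM0.le

/-! ### The scaling exponent of polar coding -/

/-- At most 4·Pub channels with Z > 1/4 fit into the code; each channel with Z < 3/4 left out
forfeits capacity at least 1/4. -/
lemma ScalingAssumption.eventually_le_gap {μ z Pub : ℝ} (h : ScalingAssumption μ)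
    (hz : z ∈ Ioo (0 : ℝ) 1) :
    ∃ c : ℝ, 0 < c ∧ ∀ᶠ n : ℕ in atTop, ∀ A : PolarCode n, A.sumErr z ≤ Pub →
      c * (2 : ℝ) ^ (-(n : ℝ) / μ) ≤ A.gap z := by
  classical
  have hμ2 := h.two_le
  have hμ0 := h.1
  have hz' := Ioo_subset_Icc_self hz
  obtain ⟨L, hL0, hL⟩ := h.2 z hz (1 / 4) (by norm_num) (3 / 4) (by norm_num) (by norm_num)
  refine ⟨L / 16, by positivity, ?_⟩
  -- As μ > 1, the allowance 2·Pub is negligible against 2^(n - n/μ).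
  have hsmall : Tendsto (fun n : ℕ => (2 : ℝ) ^ ((n : ℝ) / μ) / 2 ^ n * (2 * Pub)) atTop (𝓝 0) := by
    have hlt : (2 : ℝ) ^ (1 / μ) / 2 < 1 := by
      rw [div_lt_one two_pos]
      have : 1 / μ < 1 := by rw [div_lt_one hμ0]; linarith
      simpa using Real.rpow_lt_rpow_of_exponent_lt one_lt_two this
    have := (tendsto_pow_atTop_nhds_zero_of_lt_one (by positivity) hlt).mul_const (2 * Pub)
    rw [zero_mul] at this
    refine this.congr fun n => ?_
    rw [div_pow, ← Real.rpow_mul_natCast two_pos.le]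
    congr 3; ring
  filter_upwards [hL.eventually_const_lt (show L / 2 < L by linarith),
    hsmall.eventually_lt_const (show 0 < L / 16 by positivity)] with n h1 h2 A hA
  have hp : (0 : ℝ) < 2 ^ n := by positivity
  set B := Finset.univ.filter fun j : Fin (2 ^ n) =>
    1 / 4 < synthZ z n j ∧ synthZ z n j < 3 / 4 with hB
  have hprob : probBetween z (1 / 4) (3 / 4) n = B.card / 2 ^ n := by
    rw [probBetween, hB]
  have hcard : (B.card : ℝ) ≤ (B \ A).card + 4 * A.sumErr z := by
    have e1 : (B.card : ℝ) = (B \ A).card + (B ∩ A).card := by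
      exact_mod_cast (Finset.card_sdiff_add_card_inter B A).symm
    have e2 : ((B ∩ A).card : ℝ) * (1 / 4) ≤ A.sumErr z := by
      calc ((B ∩ A).card : ℝ) * (1 / 4) = (B ∩ A).card • (1 / 4 : ℝ) := by rw [nsmul_eq_mul]
        _ ≤ ∑ j ∈ B ∩ A, synthZ z n j :=
          Finset.card_nsmul_le_sum _ _ _ fun j hj =>
            (Finset.mem_filter.1 (Finset.mem_inter.1 hj).1).2.1.le
        _ ≤ A.sumErr z := Finset.sum_le_sum_of_subset_of_nonneg Finset.inter_subset_right
            fun j _ _ => (synthZ_mem hz' n j).1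
    linarith
  have hcompl : ((B \ A).card : ℝ) * (1 / 4) ≤ ∑ j ∈ Aᶜ, (1 - synthZ z n j) := by
    calc ((B \ A).card : ℝ) * (1 / 4) = (B \ A).card • (1 / 4 : ℝ) := by rw [nsmul_eq_mul]
      _ ≤ ∑ j ∈ B \ A, (1 - synthZ z n j) :=
        Finset.card_nsmul_le_sum _ _ _ fun j hj => by
          have := (Finset.mem_filter.1 (Finset.mem_sdiff.1 hj).1).2.2
          linarith
      _ ≤ _ := Finset.sum_le_sum_of_subset_of_nonneg
          (fun j hj => Finset.mem_compl.2 (Finset.mem_sdiff.1 hj).2)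
          fun j _ _ => by linarith [(synthZ_mem hz' n j).2]
  have hgap := A.gap_eq (z := z)
  have h3 : (B.card : ℝ) / 4 - 2 * Pub ≤ 2 ^ n * A.gap z := by linarith
  set v := (2 : ℝ) ^ ((n : ℝ) / μ) with hv
  have hv0 : 0 < v := by positivity
  have e : (2 : ℝ) ^ (-(n : ℝ) / μ) = v⁻¹ := by
    rw [hv, ← Real.rpow_neg two_pos.le]; congr 1; ring
  rw [e, ← div_eq_mul_inv, div_le_iff₀ hv0]
  rw [hprob] at h1
  have h4 : v / 2 ^ n * ((B.card : ℝ) / 4 - 2 * Pub) ≤ v / 2 ^ n * (2 ^ n * A.gap z) :=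
    mul_le_mul_of_nonneg_left h3 (by positivity)
  have e5 : v / 2 ^ n * (2 ^ n * A.gap z) = A.gap z * v := by
    field_simp
  have e6 : v / 2 ^ n * ((B.card : ℝ) / 4 - 2 * Pub) =
      v * ((B.card : ℝ) / 2 ^ n) / 4 - v / 2 ^ n * (2 * Pub) := by ring
  linarith

lemma eventually_two_pow_mul_two_rpow_neg_le {β : ℝ} (hβ : 0 < β) {c : ℝ} (hc : 0 < c) :
    ∀ᶠ n : ℕ in atTop, (2 : ℝ) ^ n * (2 : ℝ) ^ (-(2 : ℝ) ^ (β * (n : ℝ))) ≤ c := by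
  have h0 : Tendsto (fun n : ℕ => (1 / 2 : ℝ) ^ n) atTop (𝓝 0) :=
    tendsto_pow_atTop_nhds_zero_of_lt_one (by norm_num) (by norm_num)
  filter_upwards [eventually_natCast_le_two_rpow hβ (show (0 : ℝ) < 1 / 2 by norm_num),
    h0.eventually_lt_const hc] with n hn h1
  refine le_trans ?_ h1.le
  rw [← Real.rpow_natCast, ← Real.rpow_add two_pos, one_div, inv_pow, ← Real.rpow_natCast,
    ← Real.rpow_neg two_pos.le]
  exact Real.rpow_le_rpow_of_exponent_le one_le_two (by linarith)

lemma polarScalingExponent_le_of_achievable {z Pub β μ' : ℝ} (hz : z ∈ Icc (0 : ℝ) 1)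
    (hPub : 0 < Pub) (hβ : 0 < β) (h : Achievable β μ') :
    polarScalingExponent z Pub ≤ (μ' : EReal) := by
  classical
  obtain ⟨A, hA⟩ := h z hz
  -- The bound Pub is required for every n, so codes that violate it become empty; these are
  -- finitely many and the limsup is unchanged.
  refine le_trans (sInf_le ⟨fun n => if (A n).sumErr z ≤ Pub then A n else ∅, ?_, rfl⟩)
    (le_trans (le_of_eq ?_) hA.scalingExponent_le)
  · intro n
    dsimp only
    split_ifs with hc
    · exact hc
    · simpa [PolarCode.sumErr] using hPub.le
  · refine limsup_congr ?_
    filter_upwards [hA.sum_le, eventually_two_pow_mul_two_rpow_neg_le hβ hPub] with n h1 h2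
    simp only [if_pos (h1.trans h2)]

lemma exists_achievable_near {μ ε : ℝ} (hnum : NumericCondition μ) (h : ScalingAssumption μ)
    (hε : 0 < ε) : ∃ (f : ℝ → ℝ) (μs γ : ℝ), μ < μs ∧ EigenCriterion f μs ∧ γ ∈ Ioo (0 : ℝ) 1 ∧
      Achievable (0.4469 * γ) (μs / (1 - γ)) ∧ μ < μs / (1 - γ) ∧ μs / (1 - γ) < μ + ε := by
  have hμ := h.1
  obtain ⟨μs, h1, h2⟩ := exists_between (show μ < μ + ε by linarith)
  obtain ⟨f, hf⟩ := h.exists_eigenCriterion h1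
  have hc : ContinuousAt (fun γ : ℝ => μs / (1 - γ)) 0 := by
    refine ContinuousAt.div (by fun_prop) (by fun_prop) (by norm_num)
  have ev : ∀ᶠ γ : ℝ in 𝓝[>] 0, μs / (1 - γ) < μ + ε :=
    (hc.eventually_lt_const (by simpa using h2)).filter_mono nhdsWithin_le_nhds
  have ev2 : ∀ᶠ γ : ℝ in 𝓝[>] 0, γ < 1 :=
    (eventually_lt_nhds one_pos).filter_mono nhdsWithin_le_nhds
  obtain ⟨γ, h3, h4, h5⟩ := (ev.and (ev2.and self_mem_nhdsWithin)).exists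
  have h5 : 0 < γ := h5
  refine ⟨f, μs, γ, h1, hf, ⟨h5, h4⟩,
    achievable_of_eigenCriterion hμ hnum h1.le hf ⟨h5, h4⟩, ?_, h3⟩
  rw [lt_div_iff₀ (by linarith)]
  nlinarith

lemma polarScalingExponent_eq {μ z Pub : ℝ} (hnum : NumericCondition μ) (h : ScalingAssumption μ)
    (hz : z ∈ Ioo (0 : ℝ) 1) (hPub : 0 < Pub) : polarScalingExponent z Pub = (μ : EReal) := by
  apply le_antisymm
  · refine EReal.le_of_forall_lt_iff_le.1 fun x hx => ?_
    rw [EReal.coe_lt_coe_iff] at hx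
    obtain ⟨f, μs, γ, -, -, hγ, hach, -, hlt⟩ := exists_achievable_near hnum h (sub_pos.2 hx)
    refine (polarScalingExponent_le_of_achievable (Ioo_subset_Icc_self hz) hPub
      (mul_pos (by norm_num) hγ.1) hach).trans ?_
    rw [EReal.coe_le_coe_iff]; linarith
  · refine le_sInf ?_
    rintro _ ⟨A, hA, rfl⟩
    obtain ⟨c, hc, hgap⟩ := h.eventually_le_gap hz (Pub := Pub)
    exact le_seriesScalingExponent h.1 hc (hgap.mono fun n hn => hn (A n) (hA n))

/-! ### The numerical inequality -/

/-- Gibbs' inequality. The right side is affine in p: it is the tangent to the entropy at q. -/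
lemma binEntropy_le_cross_entropy {p q : ℝ} (hp : p ∈ Icc (0 : ℝ) 1) (hq : q ∈ Ioo (0 : ℝ) 1) :
    Real.binEntropy p ≤ -p * Real.log q - (1 - p) * Real.log (1 - q) := by
  have key : ∀ a b : ℝ, 0 ≤ a → 0 < b → a * Real.log a⁻¹ + a * Real.log b ≤ b - a := by
    intro a b ha hb
    rcases ha.eq_or_lt with rfl | ha
    · simpa using hb.le
    · have h := Real.log_le_sub_one_of_pos (div_pos hb ha)
      rw [Real.log_div hb.ne' ha.ne'] at h
      have h2 := mul_le_mul_of_nonneg_left h ha.le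
      rw [Real.log_inv]
      have h3 : a * (b / a - 1) = b - a := by field_simp
      linarith
  have h1 := key p q hp.1 hq.1
  have h2 := key (1 - p) (1 - q) (by linarith [hp.2]) (by linarith [hq.2])
  rw [Real.binEntropy]
  linarith

/-- Partial sums of the series for log((1+x)/(1-x)) = 2 artanh x, whose terms are nonnegative. -/
lemma le_log_of_sum_le {x c y : ℝ} (n : ℕ) (h0 : 0 ≤ x) (h1 : x < 1)
    (hc : c ≤ 2 * ∑ i ∈ Finset.range n, x ^ (2 * i + 1) / (2 * i + 1))
    (hy : (1 + x) / (1 - x) = y) : c ≤ Real.log y := by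
  have := Real.sum_range_le_log_div h0 h1 n
  rw [hy] at this
  linarith

lemma numericCondition_main : NumericCondition 3.627 := by
  have h2l := Real.log_two_gt_d9
  have h2u := Real.log_two_lt_d9
  have hl : 0 < Real.log 2 := by linarith
  -- For q = 0.39468 the arguments are 2(1-q) and 4q, close enough to 1 for short series.
  have ha : (0.191149 : ℝ) ≤ Real.log 1.21064 :=
    le_log_of_sum_le (x := 21064 / 221064) 4 (by norm_num) (by norm_num)
      (by norm_num [Finset.sum_range_succ]) (by norm_num)
  have hb : (0.456614 : ℝ) ≤ Real.log 1.57872 :=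
    le_log_of_sum_le (x := 57872 / 257872) 5 (by norm_num) (by norm_num)
      (by norm_num [Finset.sum_range_succ]) (by norm_num)
  have ea : Real.log (1 - 0.39468) = Real.log 1.21064 - Real.log 2 := by
    rw [← Real.log_div (by norm_num) (by norm_num)]; norm_num
  have eb : Real.log 0.39468 = Real.log 1.57872 - 2 * Real.log 2 := by
    rw [show (2 : ℝ) * Real.log 2 = Real.log (2 ^ 2) by rw [Real.log_pow]; norm_num,
      ← Real.log_div (by norm_num) (by norm_num)]
    norm_num
  intro ξ hξ
  -- The tangent point q is close to the value of 0.4469ξ that maximizes the left side of (2).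
  have h := binEntropy_le_cross_entropy (p := 0.4469 * ξ) (q := 0.39468)
    ⟨by linarith [hξ.1], by linarith [hξ.2]⟩ (by norm_num)
  rw [ea, eb] at h
  have key : Real.binEntropy (0.4469 * ξ) < (1 - (1 - ξ) / 3.627) * Real.log 2 := by
    refine h.trans_lt ?_
    set L := Real.log 2
    set a := Real.log 1.21064
    set b := Real.log 1.57872
    -- The affine bound is checked with a strict margin at ξ = 0 and at ξ = 1, then interpolated
    -- with weights 1 - ξ and ξ.
    have e0 : 0 ≤ (1 - 1 / 3.627) * L - (L - a) - 0.000001 := by norm_num; linarith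
    have e1 : 0 ≤ L + 0.4469 * (b - 2 * L) + 0.5531 * (a - L) - 0.000001 := by linarith
    have h0 := mul_nonneg (sub_nonneg.2 hξ.2) e0
    have h1 := mul_nonneg hξ.1 e1
    ring_nf at h0 h1 ⊢
    linarith
  have h3 : H2 (0.4469 * ξ) < 1 - (1 - ξ) / 3.627 := by
    rw [H2, div_lt_iff₀ hl]; exact key
  linarith

theorem mainTheorem2 :
    NumericCondition 3.627 ∧
    ∀ μ : ℝ, 0 < μ → NumericCondition μ →
      (∀ (h : ℝ → ℝ) (μs : ℝ), μ ≤ μs → EigenCriterion h μs → ∀ γ ∈ Ioo (0 : ℝ) 1,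
        MainCondition μs (0.4469 * γ) (μs / (1 - γ)) ∧
        Achievable (0.4469 * γ) (μs / (1 - γ))) ∧
      (ScalingAssumption μ →
        (∀ μs : ℝ, μ < μs → ∃ h : ℝ → ℝ, EigenCriterion h μs) ∧
        (∀ ε : ℝ, 0 < ε → ∃ (h : ℝ → ℝ) (μs γ β' μ' : ℝ),
          μ < μs ∧ EigenCriterion h μs ∧ γ ∈ Ioo (0 : ℝ) 1 ∧
          β' = 0.4469 * γ ∧ μ' = μs / (1 - γ) ∧
          MainCondition μs β' μ' ∧ Achievable β' μ' ∧
          0 < β' ∧ μ < μ' ∧ μ' < μ + ε) ∧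
        (∀ z ∈ Ioo (0 : ℝ) 1, ∀ Pub : ℝ, 0 < Pub →
          polarScalingExponent z Pub = (μ : EReal))) := by

  refine ⟨numericCondition_main, fun μ hμ hnum => ⟨fun h μs hle hh γ hγ =>
    ⟨mainCondition_of_numericCondition hμ hnum hle hγ,
      achievable_of_eigenCriterion hμ hnum hle hh hγ⟩,
    fun hsc => ⟨fun μs hlt => hsc.exists_eigenCriterion hlt, fun ε hε => ?_,
      fun z hz Pub hPub => polarScalingExponent_eq hnum hsc hz hPub⟩⟩⟩
  obtain ⟨f, μs, γ, h1, hf, hγ, hach, h2, h3⟩ := exists_achievable_near hnum hsc hε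
  exact ⟨f, μs, γ, 0.4469 * γ, μs / (1 - γ), h1, hf, hγ, rfl, rfl,
    mainCondition_of_numericCondition hμ hnum h1.le hγ, hach, mul_pos (by norm_num) hγ.1, h2, h3⟩
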